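/- Let $k$ be a field. A dga over $k$ is a unital associative $\mathbb{Z}$-graded $k$-algebra $A=\bigoplus_{n\in\mathbb{Z}}A^n$ with a differential $d$ of degree $+1$ satisfying $d^2=0$ and $d(xy)=d(x)y+(-1)^{|x|}x\,d(y)$. For a graded algebra $H$ with multiplication $\mu$, let $C^{n,m}(H,H)=\operatorname{Hom}_k^m(H^{\otimes n},H)$ be the $k$-linear maps $H^{\otimes n}\to H$ of degree $m$, and let $HH^{n,m}_{alg}(H,H)$ be the cohomology at $C^{n,m}(H,H)$ of the differential $C^{*,m}(H,H)\to C^{*+1,m}(H,H)$, $$f\longmapsto(-1)^m\Big(\mu(1\otimes f)+\sum_{i=0}^{n-1}(-1)^{i+1}f(1^{\otimes i}\otimes\mu\otimes1^{\otimes n-1-i})+(-1)^{n+1}\mu(f\otimes1)\Big)\qquad(f\in C^{n,m}(H,H)),$$ where the Koszul sign rule $(f\otimes g)(x\otimes y)=(-1)^{|g||x|}f(x)\otimes g(y)$ is used. Let $A$ be a dga over $k$ and let $H^*(A)$ be its homology algebra. Suppose that $$HH^{n,2-n}_{alg}(H^*(A),H^*(A))=0\quad\text{for all } n\ge 3.$$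 Then $A$ is intrinsically formal: every dga $A'$ over $k$ such that $H^*(A')\cong H^*(A)$ as graded associative $k$-algebras is quasi-isomorphic to $A$, i.e. is connected to $A$ by a finite zigzag of quasi-isomorphisms of dgas. -/

import Mathlib

open scoped DirectSum

universe u v w

/-! ### Hochschild cohomology of a graded algebra

`H = ⨁ₙ 𝓗 n` is a `ℤ`-graded associative unital `k`-algebra. -/

section Hochschild

variable {k : Type u} [CommRing k] {H : Type v} [Ring H] [Algebra k H]

/-- The linear map `x ↦ (-1) ^ (m * |x|) x`: the Koszul sign produced when a map of degree `m` is
moved past `x`. -/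
noncomputable def koszulSign (𝓗 : ℤ → Submodule k H) [GradedAlgebra 𝓗] (m : ℤ) : H →ₗ[k] H :=
  (DirectSum.toModule k ℤ H fun n : ℤ => ((m * n).negOnePow : ℤ) • (𝓗 n).subtype) ∘ₗ
    (DirectSum.decomposeLinearEquiv 𝓗).toLinearMap

theorem koszulSign_of_mem (𝓗 : ℤ → Submodule k H) [GradedAlgebra 𝓗] (m : ℤ) {n : ℤ} {x : H}
    (hx : x ∈ 𝓗 n) : koszulSign 𝓗 m x = ((m * n).negOnePow : ℤ) • x := by
  rw [koszulSign, LinearMap.comp_apply, LinearEquiv.coe_coe, DirectSum.decomposeLinearEquiv_apply,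
    DirectSum.decompose_of_mem 𝓗 hx, ← DirectSum.lof_eq_of k, DirectSum.toModule_lof]
  rfl

theorem contractNth_update {n : ℕ} (i : Fin n) (x : Fin (n + 1) → H) (j : Fin (n + 1)) :
    ∃ (j' : Fin n) (ℓ : H →ₗ[k] H), ∀ y : H,
      Fin.contractNth i.castSucc (· * ·) (Function.update x j y) =
        Function.update (Fin.contractNth i.castSucc (· * ·) x) j' (ℓ y) := by
  rcases lt_trichotomy (j : ℕ) (i : ℕ) with h | h | h
  · refine ⟨⟨j, by omega⟩, LinearMap.id, fun y => ?_⟩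
    funext a
    simp only [Fin.contractNth, Function.update_apply, Fin.ext_iff, Fin.val_castSucc, Fin.val_succ,
      LinearMap.id_apply]
    grind
  · refine ⟨i, LinearMap.mulRight k (x i.succ), fun y => ?_⟩
    funext a
    simp only [Fin.contractNth, Function.update_apply, Fin.ext_iff, Fin.val_castSucc, Fin.val_succ,
      LinearMap.mulRight_apply]
    grind
  · by_cases h' : (j : ℕ) = i + 1
    · refine ⟨i, LinearMap.mulLeft k (x i.castSucc), fun y => ?_⟩
      funext a
      simp only [Fin.contractNth, Function.update_apply, Fin.ext_iff, Fin.val_castSucc,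
        Fin.val_succ, LinearMap.mulLeft_apply]
      grind
    · refine ⟨⟨j - 1, by omega⟩, LinearMap.id, fun y => ?_⟩
      funext a
      simp only [Fin.contractNth, Function.update_apply, Fin.ext_iff, Fin.val_castSucc,
        Fin.val_succ, LinearMap.id_apply]
      grind

/-- The multilinear map `f (1^{⊗ i} ⊗ μ ⊗ 1^{⊗ (n - 1 - i)})`, which sends `(x₀, …, xₙ)` to
`f (x₀, …, xᵢ * xᵢ₊₁, …, xₙ)`. -/
def mulAt {n : ℕ} (i : Fin n) (f : MultilinearMap k (fun _ : Fin n => H) H) :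
    MultilinearMap k (fun _ : Fin (n + 1) => H) H where
  toFun x := f (Fin.contractNth i.castSucc (· * ·) x)
  map_update_add' := by
    intro inst x j y z
    obtain ⟨j', ℓ, h⟩ := contractNth_update (k := k) i x j
    have e : inst = instDecidableEqFin (n + 1) := Subsingleton.elim _ _
    subst e
    simp [h]
  map_update_smul' := by
    intro inst x j c y
    obtain ⟨j', ℓ, h⟩ := contractNth_update (k := k) i x j
    have e : inst = instDecidableEqFin (n + 1) := Subsingleton.elim _ _
    subst e
    simp [h]

/-- The multilinear map `μ (1 ⊗ f)` for `f` of internal degree `m`; with the Koszul sign, it sends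
`(x₀, …, xₙ)` to `(-1) ^ (m * |x₀|) x₀ * f (x₁, …, xₙ)`. -/
noncomputable def mulOneTensor (𝓗 : ℤ → Submodule k H) [GradedAlgebra 𝓗] {n : ℕ} (m : ℤ)
    (f : MultilinearMap k (fun _ : Fin n => H) H) :
    MultilinearMap k (fun _ : Fin (n + 1) => H) H :=
  LinearMap.uncurryLeft (M := fun _ : Fin (n + 1) => H)
    { toFun := fun y => (LinearMap.mulLeft k (koszulSign 𝓗 m y)).compMultilinearMap f
      map_add' := fun y z => by ext; simp [add_mul]
      map_smul' := fun c y => by ext; simp }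

/-- The multilinear map `μ (f ⊗ 1)`, which sends `(x₀, …, xₙ)` to `f (x₀, …, xₙ₋₁) * xₙ`. -/
noncomputable def mulTensorOne {n : ℕ} (f : MultilinearMap k (fun _ : Fin n => H) H) :
    MultilinearMap k (fun _ : Fin (n + 1) => H) H :=
  MultilinearMap.uncurryRight (M := fun _ : Fin (n + 1) => H)
    ((LinearMap.mul k H).compMultilinearMap f)

theorem mulOneTensor_apply (𝓗 : ℤ → Submodule k H) [GradedAlgebra 𝓗] {n : ℕ} (m : ℤ)
    (f : MultilinearMap k (fun _ : Fin n => H) H) (x : Fin (n + 1) → H) :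
    mulOneTensor 𝓗 m f x = koszulSign 𝓗 m (x 0) * f (Fin.tail x) := rfl

theorem mulTensorOne_apply {n : ℕ} (f : MultilinearMap k (fun _ : Fin n => H) H)
    (x : Fin (n + 1) → H) : mulTensorOne f x = f (Fin.init x) * x (Fin.last n) := rfl

/-- The Hochschild differential, as a linear operator on all multilinear maps, with the signs that
belong to maps of internal degree `m`. It sends `f` to
`(-1) ^ m * (μ (1 ⊗ f) + ∑ i < n, (-1) ^ (i + 1) f (1^{⊗ i} ⊗ μ ⊗ 1^{⊗ (n - 1 - i)})
  + (-1) ^ (n + 1) μ (f ⊗ 1))`. -/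
noncomputable def hochschildDelta (𝓗 : ℤ → Submodule k H) [GradedAlgebra 𝓗] (n : ℕ) (m : ℤ) :
    MultilinearMap k (fun _ : Fin n => H) H →ₗ[k]
      MultilinearMap k (fun _ : Fin (n + 1) => H) H where
  toFun f := (m.negOnePow : ℤ) •
    (mulOneTensor 𝓗 m f + ∑ i : Fin n, (-1 : ℤ) ^ ((i : ℕ) + 1) • mulAt i f
      + (-1 : ℤ) ^ (n + 1) • mulTensorOne f)
  map_add' f g := by
    ext x
    simp only [add_apply, smul_apply, sum_apply,
      mulOneTensor_apply, mulTensorOne_apply, mulAt, MultilinearMap.coe_mk, mul_add, add_mul,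
      smul_add, Finset.sum_add_distrib]
    abel
  map_smul' c f := by
    ext x
    simp only [add_apply, smul_apply, sum_apply,
      mulOneTensor_apply, mulTensorOne_apply, mulAt, MultilinearMap.coe_mk, mul_smul_comm,
      smul_mul_assoc, smul_add, Finset.smul_sum, RingHom.id_apply, smul_comm _ c]

theorem hochschildDelta_apply (𝓗 : ℤ → Submodule k H) [GradedAlgebra 𝓗] (n : ℕ) (m : ℤ)
    (f : MultilinearMap k (fun _ : Fin n => H) H) (x : Fin (n + 1) → H) :
    hochschildDelta 𝓗 n m f x = (m.negOnePow : ℤ) •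
      (koszulSign 𝓗 m (x 0) * f (Fin.tail x)
        + ∑ i : Fin n, (-1 : ℤ) ^ ((i : ℕ) + 1) • f (Fin.contractNth i.castSucc (· * ·) x)
        + (-1 : ℤ) ^ (n + 1) • (f (Fin.init x) * x (Fin.last n))) := by
  simp [hochschildDelta, mulOneTensor_apply, mulTensorOne_apply, mulAt]

/-- The Hochschild cochains `C^{n,m}(H, H) = Hom_k^m(H^{⊗ n}, H)`: multilinear maps in `n`
variables that raise the total internal degree by `m`. -/
def hochschildCochains (𝓗 : ℤ → Submodule k H) (n : ℕ) (m : ℤ) :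
    Submodule k (MultilinearMap k (fun _ : Fin n => H) H) where
  carrier := {f | ∀ (p : Fin n → ℤ) (x : Fin n → H), (∀ j, x j ∈ 𝓗 (p j)) →
    f x ∈ 𝓗 (∑ j, p j + m)}
  add_mem' hf hg p x hx := add_mem (hf p x hx) (hg p x hx)
  zero_mem' _ _ _ := zero_mem _
  smul_mem' c _ hf p x hx := Submodule.smul_mem _ c (hf p x hx)

theorem sum_contractNth {n : ℕ} (i : Fin n) (p : Fin (n + 1) → ℤ) :
    ∑ j, Fin.contractNth i.castSucc (· + ·) p j = ∑ j, p j := by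
  induction n with
  | zero => exact i.elim0
  | succ n ih =>
    rw [Fin.sum_univ_succ, Fin.sum_univ_succ (n := n + 1)]
    refine Fin.cases ?_ (fun i => ?_) i
    · rw [Fin.sum_univ_succ (n := n), ← add_assoc]
      congr 1
    · have := ih i (Fin.tail p)
      simp only [Fin.tail] at this
      rw [← this]
      congr 1
      refine Finset.sum_congr rfl fun j _ => ?_
      simp [Fin.contractNth, Fin.tail]

theorem hochschildDelta_mem (𝓗 : ℤ → Submodule k H) [GradedAlgebra 𝓗] (n : ℕ) (m : ℤ)
    {f : MultilinearMap k (fun _ : Fin n => H) H} (hf : f ∈ hochschildCochains 𝓗 n m) :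
    hochschildDelta 𝓗 n m f ∈ hochschildCochains 𝓗 (n + 1) m := by
  intro p x hx
  rw [hochschildDelta_apply]
  refine zsmul_mem (add_mem (add_mem ?_ (sum_mem fun i _ => zsmul_mem ?_ _)) (zsmul_mem ?_ _)) _
  · rw [koszulSign_of_mem 𝓗 m (hx 0), Fin.sum_univ_succ, add_assoc]
    exact SetLike.mul_mem_graded (zsmul_mem (hx 0) _) (hf _ _ fun j => hx j.succ)
  · rw [← sum_contractNth i p]
    refine hf _ _ fun j => ?_
    simp only [Fin.contractNth]
    split_ifs
    · exact hx _
    · exact SetLike.mul_mem_graded (hx _) (hx _)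
    · exact hx _
  · rw [Fin.sum_univ_castSucc, add_right_comm]
    exact SetLike.mul_mem_graded (hf _ _ fun j => hx j.castSucc) (hx _)

/-- The `k`-module `C^{n,m}(H, H)` of Hochschild cochains. -/
def HochschildCochain (𝓗 : ℤ → Submodule k H) (n : ℕ) (m : ℤ) : Type v :=
  hochschildCochains 𝓗 n m

noncomputable instance (𝓗 : ℤ → Submodule k H) (n : ℕ) (m : ℤ) :
    AddCommGroup (HochschildCochain 𝓗 n m) :=
  inferInstanceAs (AddCommGroup (hochschildCochains 𝓗 n m))

noncomputable instance (𝓗 : ℤ → Submodule k H) (n : ℕ) (m : ℤ) :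
    Module k (HochschildCochain 𝓗 n m) :=
  inferInstanceAs (Module k (hochschildCochains 𝓗 n m))

/-- The Hochschild differential `C^{n,m}(H, H) → C^{n+1,m}(H, H)`. -/
noncomputable def hochschildD (𝓗 : ℤ → Submodule k H) [GradedAlgebra 𝓗] (n : ℕ) (m : ℤ) :
    HochschildCochain 𝓗 n m →ₗ[k] HochschildCochain 𝓗 (n + 1) m :=
  (hochschildDelta 𝓗 n m).restrict (p := hochschildCochains 𝓗 n m)
    (q := hochschildCochains 𝓗 (n + 1) m) fun _ hf => hochschildDelta_mem 𝓗 n m hf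

/-- The Hochschild coboundaries in `C^{n,m}(H, H)`. -/
noncomputable def hochschildBoundaries (𝓗 : ℤ → Submodule k H) [GradedAlgebra 𝓗] :
    (n : ℕ) → (m : ℤ) → Submodule k (HochschildCochain 𝓗 n m)
  | 0, _ => ⊥
  | n + 1, m => LinearMap.range (hochschildD 𝓗 n m)

/-- The Hochschild cohomology `HH^{n,m}_{alg}(H, H)` of the graded algebra `H`, in cohomological
degree `n` and internal degree `m`: cocycles modulo coboundaries. -/
abbrev HH (𝓗 : ℤ → Submodule k H) [GradedAlgebra 𝓗] (n : ℕ) (m : ℤ) : Type v :=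
  LinearMap.ker (hochschildD 𝓗 n m) ⧸
    (hochschildBoundaries 𝓗 n m).submoduleOf (LinearMap.ker (hochschildD 𝓗 n m))

end Hochschild

/-! ### Differential graded algebras -/

/-- A (unital, associative, `ℤ`-graded, cohomologically graded) differential graded algebra over
`k`. The graded module is `⨁ₙ deg n`, and the differential has degree `1`. -/
structure DGA (k : Type u) [CommRing k] where
  carrier : Type v
  [ring : Ring carrier]
  [algebra : Algebra k carrier]
  deg : ℤ → Submodule k carrier
  [graded : GradedAlgebra deg]
  d : carrier →ₗ[k] carrier
  d_mem : ∀ {n : ℤ} {x : carrier}, x ∈ deg n → d x ∈ deg (n + 1)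
  d_d : ∀ x : carrier, d (d x) = 0
  d_mul : ∀ {n : ℤ} {x : carrier}, x ∈ deg n → ∀ y : carrier,
    d (x * y) = d x * y + (n.negOnePow : ℤ) • (x * d y)

namespace DGA

variable {k : Type u} [CommRing k]

attribute [instance] DGA.ring DGA.algebra DGA.graded

section Homology

variable (A : DGA.{u, v} k)

/-- The component of degree `n` of the differential of `x`. -/
theorem d_decompose (x : A.carrier) (n : ℤ) :
    A.d (DirectSum.decompose A.deg x n) = DirectSum.decompose A.deg (A.d x) (n + 1) := by
  induction x using DirectSum.Decomposition.inductionOn A.deg with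
  | zero => simp
  | @homogeneous i m =>
    by_cases h : i = n
    · subst h
      rw [DirectSum.decompose_of_mem_same _ m.2, DirectSum.decompose_of_mem_same _ (A.d_mem m.2)]
    · rw [DirectSum.decompose_of_mem_ne _ m.2 h, DirectSum.decompose_of_mem_ne _ (A.d_mem m.2)
        (by omega), map_zero]
  | add x y hx hy => simp [DirectSum.decompose_add, hx, hy]

theorem d_one : A.d 1 = 0 := by
  have h := A.d_mul (SetLike.one_mem_graded A.deg) 1
  simpa using h

theorem d_mul_of_d_eq_zero (x : A.carrier) {y : A.carrier} (hy : A.d y = 0) :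
    A.d (x * y) = A.d x * y := by
  induction x using DirectSum.Decomposition.inductionOn A.deg with
  | zero => simp
  | homogeneous m => simp [A.d_mul m.2, hy]
  | add x x' hx hx' => simp [add_mul, hx, hx']

/-- For a cocycle `x`, the element `x * d y` is a coboundary. -/
theorem mul_d_of_d_eq_zero {x : A.carrier} (hx : A.d x = 0) (y : A.carrier) :
    ∃ z, A.d z = x * A.d y := by
  classical
  refine ⟨∑ n ∈ (DirectSum.decompose A.deg x).support,
    (n.negOnePow : ℤ) • ((DirectSum.decompose A.deg x n : A.carrier) * y), ?_⟩
  conv_rhs => rw [← DirectSum.sum_support_decompose A.deg x, Finset.sum_mul]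
  rw [map_sum]
  refine Finset.sum_congr rfl fun n _ => ?_
  rw [map_zsmul, A.d_mul (SetLike.coe_mem _), d_decompose, hx]
  rw [DirectSum.decompose_zero, DirectSum.zero_apply, ZeroMemClass.coe_zero, zero_mul, zero_add, smul_smul, ← Units.val_mul,
    Int.units_mul_self, Units.val_one, one_smul]

/-- The subalgebra `ker d` of cocycles. -/
def cocycles : Subalgebra k A.carrier where
  carrier := {x | A.d x = 0}
  mul_mem' {x y} hx hy := by
    have hx' : A.d x = 0 := hx
    simp [A.d_mul_of_d_eq_zero x hy, hx']
  add_mem' {x y} hx hy := by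
    have hx' : A.d x = 0 := hx
    have hy' : A.d y = 0 := hy
    simp [hx', hy']
  algebraMap_mem' c := by simp [Algebra.algebraMap_eq_smul_one, A.d_one]

theorem d_coe_cocycles (z : A.cocycles) : A.d z = 0 := z.2

/-- The two-sided ideal `im d` of coboundaries in the algebra of cocycles. -/
def coboundaries : Ideal A.cocycles where
  carrier := {z | ∃ y, A.d y = z}
  add_mem' := by
    rintro a b ⟨y, hy⟩ ⟨z, hz⟩
    exact ⟨y + z, by simp [hy, hz]⟩
  zero_mem' := ⟨0, by simp⟩
  smul_mem' := by
    rintro c a ⟨y, hy⟩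
    obtain ⟨z, hz⟩ := A.mul_d_of_d_eq_zero c.2 y
    exact ⟨z, by simp [hz, hy]⟩

instance : A.coboundaries.IsTwoSided where
  mul_mem_of_left := by
    rintro a b ⟨y, hy⟩
    exact ⟨y * b, by simp [A.d_mul_of_d_eq_zero y b.2, hy]⟩

/-- The homology algebra `H^*(A) = ker d / im d`. -/
def Homology : Type v := A.cocycles ⧸ A.coboundaries

noncomputable instance : Ring A.Homology := inferInstanceAs (Ring (A.cocycles ⧸ A.coboundaries))

noncomputable instance : Algebra k A.Homology :=
  inferInstanceAs (Algebra k (A.cocycles ⧸ A.coboundaries))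

/-- The class of a cocycle. -/
noncomputable def toHomology : A.cocycles →ₐ[k] A.Homology := Ideal.Quotient.mkₐ k A.coboundaries

/-- The degree `n` part `H^n(A)`: the classes of the cocycles of degree `n`. -/
noncomputable def homologyDeg (n : ℤ) : Submodule k A.Homology :=
  ((A.deg n).comap A.cocycles.val.toLinearMap).map A.toHomology.toLinearMap

theorem mem_homologyDeg {n : ℤ} {x : A.Homology} :
    x ∈ A.homologyDeg n ↔ ∃ z : A.cocycles, (z : A.carrier) ∈ A.deg n ∧ A.toHomology z = x :=
  Iff.rfl

theorem toHomology_surjective : Function.Surjective A.toHomology :=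
  Ideal.Quotient.mkₐ_surjective k _

theorem toHomology_eq_zero {z : A.cocycles} : A.toHomology z = 0 ↔ ∃ y, A.d y = z :=
  Ideal.Quotient.eq_zero_iff_mem

/-- The component of degree `n` of a cocycle. -/
def cocycleProj (n : ℤ) : A.cocycles →ₗ[k] A.cocycles where
  toFun z := ⟨DirectSum.decompose A.deg (z : A.carrier) n, by
    change A.d _ = 0
    rw [d_decompose, d_coe_cocycles]
    simp⟩
  map_add' _ _ := by ext; simp [DirectSum.decompose_add]
  map_smul' _ _ := by ext; simp [DirectSum.decompose_smul, DirectSum.smul_apply]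

/-- The component of degree `n` of a homology class. -/
noncomputable def homologyProj (n : ℤ) : A.Homology →ₗ[k] A.Homology :=
  ((A.coboundaries.restrictScalars k).liftQ (A.toHomology.toLinearMap ∘ₗ A.cocycleProj n) (by
    rintro z ⟨y, hy⟩
    refine A.toHomology_eq_zero.2 ⟨DirectSum.decompose A.deg y (n - 1), ?_⟩
    rw [d_decompose, hy]
    exact congrArg (fun m => (DirectSum.decompose A.deg (z : A.carrier) m : A.carrier))
      (sub_add_cancel n 1)))

theorem homologyProj_toHomology (n : ℤ) (z : A.cocycles) :
    A.homologyProj n (A.toHomology z) = A.toHomology (A.cocycleProj n z) := rfl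

theorem homologyProj_of_mem {n m : ℤ} {x : A.Homology} (hx : x ∈ A.homologyDeg m) :
    A.homologyProj n x = if m = n then x else 0 := by
  obtain ⟨z, hz, rfl⟩ := A.mem_homologyDeg.1 hx
  rw [homologyProj_toHomology]
  split_ifs with h
  · subst h
    congr 1
    ext
    exact DirectSum.decompose_of_mem_same _ hz
  · rw [← map_zero A.toHomology]
    congr 1
    ext
    exact DirectSum.decompose_of_mem_ne _ hz h

theorem homologyDeg_isInternal : DirectSum.IsInternal A.homologyDeg := by
  classical
  constructor
  · rw [injective_iff_map_eq_zero]
    intro x hx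
    have key : ∀ (n : ℤ) (x : ⨁ n, A.homologyDeg n),
        A.homologyProj n (DirectSum.coeAddMonoidHom A.homologyDeg x) = x n := by
      intro n x
      induction x using DirectSum.induction_on with
      | zero => simp
      | of i y =>
        rw [DirectSum.coeAddMonoidHom_of, A.homologyProj_of_mem y.2, DirectSum.coe_of_apply]
        split_ifs <;> rfl
      | add x y hx hy => simp [hx, hy]
    ext n
    rw [← key, hx]
    simp
  · intro x
    obtain ⟨z, rfl⟩ := A.toHomology_surjective x
    refine ⟨∑ n ∈ (DirectSum.decompose A.deg (z : A.carrier)).support,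
      DirectSum.of (fun n => A.homologyDeg n) n
        ⟨A.toHomology (A.cocycleProj n z), A.cocycleProj n z,
          SetLike.coe_mem (DirectSum.decompose A.deg (z : A.carrier) n), rfl⟩, ?_⟩
    simp only [map_sum, DirectSum.coeAddMonoidHom_of]
    rw [← map_sum]
    congr 1
    ext
    rw [AddSubmonoidClass.coe_finsetSum]
    exact DirectSum.sum_support_decompose A.deg (z : A.carrier)

noncomputable instance : GradedAlgebra A.homologyDeg where
  one_mem := ⟨1, SetLike.one_mem_graded A.deg, map_one A.toHomology⟩
  mul_mem := by
    rintro i j _ _ ⟨x, hx, rfl⟩ ⟨y, hy, rfl⟩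
    exact ⟨x * y, SetLike.mul_mem_graded (A := A.deg) hx hy, map_mul A.toHomology x y⟩
  toDecomposition := A.homologyDeg_isInternal.chooseDecomposition

end Homology

/-- Morphisms of differential graded algebras: unital algebra maps of degree `0` that commute with
the differentials. -/
structure Hom (A : DGA.{u, v} k) (B : DGA.{u, w} k) where
  toAlgHom : A.carrier →ₐ[k] B.carrier
  map_deg : ∀ {n : ℤ} {x : A.carrier}, x ∈ A.deg n → toAlgHom x ∈ B.deg n
  map_d : ∀ x : A.carrier, toAlgHom (A.d x) = B.d (toAlgHom x)

section HomologyMap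

variable {A : DGA.{u, v} k} {B : DGA.{u, w} k} (f : Hom A B)

/-- The map induced on cocycles. -/
def Hom.cocyclesMap : A.cocycles →ₐ[k] B.cocycles :=
  (f.toAlgHom.comp A.cocycles.val).codRestrict B.cocycles fun z => by
    change B.d (f.toAlgHom z) = 0
    rw [← f.map_d, d_coe_cocycles, map_zero]

/-- The algebra map `H^*(f) : H^*(A) → H^*(B)`. -/
noncomputable def Hom.homologyMap : A.Homology →ₐ[k] B.Homology :=
  Ideal.Quotient.liftₐ A.coboundaries (B.toHomology.comp f.cocyclesMap) (by
    rintro z ⟨y, hy⟩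
    refine B.toHomology_eq_zero.2 ⟨f.toAlgHom y, ?_⟩
    rw [← f.map_d, hy]
    rfl)

/-- A quasi-isomorphism: a morphism that induces an isomorphism on homology. -/
def Hom.IsQuasiIso : Prop := Function.Bijective f.homologyMap

end HomologyMap

/-- Two dgas are quasi-isomorphic if they are joined by a finite zigzag of quasi-isomorphisms of
dgas. -/
def QuasiIsomorphic : DGA.{u, v} k → DGA.{u, v} k → Prop :=
  Relation.EqvGen fun A B => ∃ f : Hom A B, f.IsQuasiIso

/-- `H^*(A) ≅ H^*(B)` as graded associative `k`-algebras. -/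
def HomologyIso (A B : DGA.{u, v} k) : Prop :=
  ∃ e : A.Homology ≃ₐ[k] B.Homology,
    ∀ (n : ℤ) (x : A.Homology), x ∈ A.homologyDeg n ↔ e x ∈ B.homologyDeg n

/-- A dga `A` is intrinsically formal if every dga with homology algebra isomorphic to that of `A`
is quasi-isomorphic to `A`. -/
def IntrinsicallyFormal (A : DGA.{u, v} k) : Prop :=
  ∀ A' : DGA.{u, v} k, HomologyIso A A' → QuasiIsomorphic A' A

end DGA

/-! Let H be the graded algebra $H^*(A)$ with zero differential. Every dga B with homology H, in
particular both A and A', is shown to be quasi-isomorphic to H; joining the two zigzags gives the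
claim. The intermediate object is an $A_\infty$-morphism from H to B, packaged as one cochain τ on
lists of elements of H. It is multilinear of total degree 1, so its component in arity n has
internal degree 1 - n, and it satisfies the Maurer–Cartan equation `curvature ε d τ = 0`.

Such a τ is built by obstruction theory. Over a field, a linear choice of cocycles gives arity 1,
and arity 2 exists because that choice is multiplicative up to boundaries. If the curvature vanishes
through arity N, the Bianchi identity shows that in arity N + 1 it has cocycle values, and one arity
higher that their classes form a Hochschild cocycle of bidegree (n, 2 - n) with n = N + 1. The
hypothesis makes this a coboundary. A lift of a signed primitive, added to τ in arity N, makes the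
curvature in arity N + 1 exact, and a correction in arity N + 1 then kills it
(`IsPartialTwisting.exists_succ`). Every arity stabilises after finitely many stages, so a limit
exists (`exists_isTwisting`).

Given τ, consider upper triangular matrices with diagonal entries in B and H and a B-valued cochain
on H off the diagonal, with the differential twisted by τ. The two diagonal projections are dga maps
to B and to H. Inserting the unit as first argument contracts the twisted cochains up to multiples
of τ (`twistD_insertOne`). Hence a homogeneous cocycle of B and an element of H occur together in a
matrix cocycle exactly when the first represents the second, and both projections are
quasi-isomorphisms. -/

set_option linter.unusedSectionVars false

/-! ### Cochains as functions on lists -/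

namespace ListCochain

/-! ### The bar differential, by recursion on the list of arguments. -/

section Bar

variable {k : Type*} [CommRing k] {H : Type*} [Ring H]
  {W : Type*} [AddCommGroup W] [Module k W]

/-- Fix the first argument of a cochain. -/
def shift (x : H) (φ : List H → W) : List H → W := fun l => φ (x :: l)

/-- Multiply the first argument of a cochain from the left. -/
def mulHead (φ : List H → W) (y : H) : List H → W
  | [] => 0
  | x :: l => φ (y * x :: l)

/-- The total differential on cochains: it combines the differential `d` of the coefficients (with
the sign `(-1) ^ n` in arity `n`) with the bar differential. -/
def barD (d : W →ₗ[k] W) : (List H → W) → List H → W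
  | φ, [] => d (φ [])
  | φ, x :: l => -mulHead φ x l - barD d (shift x φ) l

variable (d : W →ₗ[k] W)

@[simp] theorem shift_apply (x : H) (φ : List H → W) (l : List H) : shift x φ l = φ (x :: l) := rfl

@[simp] theorem mulHead_nil (φ : List H → W) (y : H) : mulHead φ y [] = 0 := rfl

@[simp] theorem mulHead_cons (φ : List H → W) (y x : H) (l : List H) :
    mulHead φ y (x :: l) = φ (y * x :: l) := rfl

@[simp] theorem barD_nil (φ : List H → W) : barD d φ [] = d (φ []) := rfl

theorem barD_cons (φ : List H → W) (x : H) (l : List H) :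
    barD d φ (x :: l) = -mulHead φ x l - barD d (shift x φ) l := rfl

theorem shift_barD (x : H) (φ : List H → W) :
    shift x (barD d φ) = -mulHead φ x - barD d (shift x φ) := rfl

theorem shift_add (x : H) (φ ψ : List H → W) : shift x (φ + ψ) = shift x φ + shift x ψ := rfl

theorem shift_neg (x : H) (φ : List H → W) : shift x (-φ) = -shift x φ := rfl

theorem shift_smul (c : k) (x : H) (φ : List H → W) : shift x (c • φ) = c • shift x φ := rfl

theorem shift_mulHead (φ : List H → W) (x y : H) : shift x (mulHead φ y) = shift (y * x) φ := rfl

theorem mulHead_add (φ ψ : List H → W) (y : H) :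
    mulHead (φ + ψ) y = mulHead φ y + mulHead ψ y := by
  funext l; cases l <;> simp

theorem mulHead_neg (φ : List H → W) (y : H) : mulHead (-φ) y = -mulHead φ y := by
  funext l; cases l <;> simp

theorem mulHead_smul (c : k) (φ : List H → W) (y : H) :
    mulHead (c • φ) y = c • mulHead φ y := by
  funext l; cases l <;> simp

theorem mulHead_mulHead (φ : List H → W) (y z : H) :
    mulHead (mulHead φ y) z = mulHead φ (y * z) := by
  funext l; cases l <;> simp [mul_assoc]

theorem barD_add_apply (φ ψ : List H → W) (l : List H) :
    barD d (φ + ψ) l = barD d φ l + barD d ψ l := by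
  induction l generalizing φ ψ with
  | nil => simp
  | cons x l ih => simp only [barD_cons, shift_add, ih, mulHead_add, Pi.add_apply]; abel

theorem barD_smul_apply (c : k) (φ : List H → W) (l : List H) :
    barD d (c • φ) l = c • barD d φ l := by
  induction l generalizing φ with
  | nil => simp
  | cons x l ih =>
    simp only [barD_cons, shift_smul, ih, mulHead_smul, Pi.smul_apply, smul_sub, smul_neg]

/-- `barD` as a linear map. -/
def barDₗ : (List H → W) →ₗ[k] (List H → W) where
  toFun := barD d
  map_add' φ ψ := funext fun l => barD_add_apply d φ ψ l
  map_smul' c φ := funext fun l => barD_smul_apply d c φ l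

theorem barD_add (φ ψ : List H → W) : barD d (φ + ψ) = barD d φ + barD d ψ :=
  map_add (barDₗ d) φ ψ

theorem barD_sub (φ ψ : List H → W) : barD d (φ - ψ) = barD d φ - barD d ψ :=
  map_sub (barDₗ d) φ ψ

theorem barD_neg (φ : List H → W) : barD d (-φ) = -barD d φ :=
  map_neg (barDₗ d) φ

theorem barD_zero : barD d (0 : List H → W) = 0 :=
  map_zero (barDₗ d)

/-- Associativity of `H` enters here: multiplying the first argument by `y` and then contracting it
with the next one is the same in either order. -/
theorem barD_mulHead (φ : List H → W) (y : H) :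
    barD d (mulHead φ y) = mulHead (barD d φ) y := by
  funext l
  cases l with
  | nil => simp
  | cons x l => simp [barD_cons, mulHead_mulHead, shift_mulHead]

/-- Unfolding the recursion at `x :: l` leaves two copies of `barD d (mulHead φ x)` with opposite
signs, by `barD_mulHead`, and the square applied to the shorter list. -/
theorem barD_barD (hd : ∀ a, d (d a) = 0) (φ : List H → W) : barD d (barD d φ) = 0 := by
  funext l
  induction l generalizing φ with
  | nil => simp [hd]
  | cons x l ih =>
    have h := ih (shift x φ)
    rw [barD_cons, shift_barD, barD_sub, barD_neg, barD_mulHead]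
    simp [h]

/-- Separates the part that preserves arity from the part that raises it by one; the obstruction
argument treats the two separately. -/
theorem barD_apply (φ : List H → W) (l : List H) :
    barD d φ l = (-1 : ℤ) ^ l.length • d (φ l) + barD (0 : W →ₗ[k] W) φ l := by
  induction l generalizing φ with
  | nil => simp
  | cons x l ih =>
    rw [barD_cons, barD_cons, ih, List.length_cons, pow_succ, mul_neg_one, neg_smul, shift_apply]
    abel

/-- The bar differential in arity `n + 1` only depends on the cochain in arity `n`. -/
theorem barD_zero_eq_zero {φ : List H → W} {l : List H}
    (h : ∀ l' : List H, l'.length + 1 = l.length → φ l' = 0) :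
    barD (0 : W →ₗ[k] W) φ l = 0 := by
  induction l generalizing φ with
  | nil => simp
  | cons x l ih =>
    rw [barD_cons, ih (φ := shift x φ) fun l' hl' => h (x :: l') (by simpa using hl')]
    cases l with
    | nil => simp
    | cons y l => simp [h (x * y :: l) (by simp)]

end Bar

/-! ### Cup product, parity and the twisted differential on cochains. -/

section Cup

variable {k : Type*} [CommRing k] {H : Type*} [Ring H]
  {A : Type*} [Ring A] [Algebra k A]

/-- An algebra with a square-zero derivation `d`, twisted by an involution `ε` that
anticommutes with `d`: this is what is left of a dga if one only remembers the parity operator. -/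
structure IsTwistedDifferential (ε : A →ₐ[k] A) (d : A →ₗ[k] A) : Prop where
  invol : ∀ a, ε (ε a) = a
  anticomm : ∀ a, d (ε a) = -ε (d a)
  sq_zero : ∀ a, d (d a) = 0
  leibniz : ∀ a b, d (a * b) = d a * b + ε a * d b

variable (ε : A →ₐ[k] A) (d : A →ₗ[k] A)

/-- The left action of coefficients on cochains. -/
def act (a : A) (φ : List H → A) : List H → A := fun l => (ε ^ l.length) a * φ l

/-- The parity operator on cochains. -/
def parity (φ : List H → A) : List H → A := fun l => (-1 : ℤ) ^ l.length • ε (φ l)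

/-- The cup product of cochains: the sum of `± φ l₁ * ψ l₂` over the splittings
`l = l₁ ++ l₂`. -/
def cup : (List H → A) → (List H → A) → List H → A
  | φ, ψ, [] => φ [] * ψ []
  | φ, ψ, x :: l => (ε ^ (l.length + 1)) (φ []) * ψ (x :: l) + cup (shift x φ) ψ l

@[simp] theorem cup_nil (φ ψ : List H → A) : cup ε φ ψ [] = φ [] * ψ [] := rfl

theorem cup_cons (φ ψ : List H → A) (x : H) (l : List H) :
    cup ε φ ψ (x :: l) = (ε ^ (l.length + 1)) (φ []) * ψ (x :: l) + cup ε (shift x φ) ψ l := rfl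

theorem pow_succ_apply (n : ℕ) (a : A) : (ε ^ (n + 1)) a = (ε ^ n) (ε a) := by
  rw [pow_succ]; rfl

theorem pow_comm_apply (n : ℕ) (a : A) : (ε ^ n) (ε a) = ε ((ε ^ n) a) := by
  rw [← pow_succ_apply, pow_succ']; rfl

theorem shift_act (a : A) (φ : List H → A) (x : H) :
    shift x (act ε a φ) = act ε (ε a) (shift x φ) := by
  funext l; simp [act, pow_succ_apply]

/-- Fixing the first argument splits off the term in which `φ` receives no argument. With
`shift_parity` and `shift_barD` it reduces the identities below to inductions on the list. -/
theorem shift_cup (φ ψ : List H → A) (x : H) :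
    shift x (cup ε φ ψ) = act ε (ε (φ [])) (shift x ψ) + cup ε (shift x φ) ψ := by
  funext l; simp [cup_cons, act, pow_succ_apply]

theorem shift_parity (φ : List H → A) (x : H) :
    shift x (parity ε φ) = -parity ε (shift x φ) := by
  funext l; simp [parity, pow_succ]

theorem act_add (a : A) (φ ψ : List H → A) : act ε a (φ + ψ) = act ε a φ + act ε a ψ := by
  funext l; simp [act, mul_add]

theorem act_sub (a : A) (φ ψ : List H → A) : act ε a (φ - ψ) = act ε a φ - act ε a ψ := by
  funext l; simp [act, mul_sub]

theorem act_neg (a : A) (φ : List H → A) : act ε a (-φ) = -act ε a φ := by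
  funext l; simp [act]

theorem act_smul (c : k) (a : A) (φ : List H → A) : act ε a (c • φ) = c • act ε a φ := by
  funext l; simp [act]

theorem act_zero (a : A) : act ε a (0 : List H → A) = 0 := by
  funext l; simp [act]

theorem add_act (a b : A) (φ : List H → A) : act ε (a + b) φ = act ε a φ + act ε b φ := by
  funext l; simp [act, add_mul]

theorem neg_act (a : A) (φ : List H → A) : act ε (-a) φ = -act ε a φ := by
  funext l; simp [act]

theorem smul_act (c : k) (a : A) (φ : List H → A) : act ε (c • a) φ = c • act ε a φ := by
  funext l; simp [act]

theorem zero_act (φ : List H → A) : act ε 0 φ = 0 := by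
  funext l; simp [act]

theorem one_act (φ : List H → A) : act ε 1 φ = φ := by
  funext l; simp [act]

theorem mul_act (a b : A) (φ : List H → A) : act ε (a * b) φ = act ε a (act ε b φ) := by
  funext l; simp [act, mul_assoc]

theorem act_mulHead (a : A) (φ : List H → A) (y : H) :
    act ε a (mulHead φ y) = mulHead (act ε a φ) y := by
  funext l; cases l <;> simp [act]

theorem parity_add (φ ψ : List H → A) : parity ε (φ + ψ) = parity ε φ + parity ε ψ := by
  funext l; simp [parity]

theorem parity_sub (φ ψ : List H → A) : parity ε (φ - ψ) = parity ε φ - parity ε ψ := by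
  funext l; simp [parity, smul_sub]

theorem parity_smul (c : k) (φ : List H → A) : parity ε (c • φ) = c • parity ε φ := by
  funext l; simp [parity]

theorem parity_act (a : A) (φ : List H → A) :
    parity ε (act ε a φ) = act ε (ε a) (parity ε φ) := by
  funext l; simp [parity, act, pow_comm_apply, -zsmul_eq_mul]

theorem parity_mulHead (φ : List H → A) (y : H) :
    parity ε (mulHead φ y) = mulHead (parity ε φ) y := by
  funext l; cases l <;> simp [parity]

theorem cup_add_left (φ φ' ψ : List H → A) :
    cup ε (φ + φ') ψ = cup ε φ ψ + cup ε φ' ψ := by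
  funext l
  induction l generalizing φ φ' with
  | nil => simp [add_mul]
  | cons x l ih =>
    simp only [cup_cons, shift_add, ih, Pi.add_apply, map_add, add_mul]; abel

theorem cup_smul_left (c : k) (φ ψ : List H → A) :
    cup ε (c • φ) ψ = c • cup ε φ ψ := by
  funext l
  induction l generalizing φ with
  | nil => simp
  | cons x l ih =>
    have hx := ih (shift x φ)
    have e : shift x (c • φ) = c • shift x φ := rfl
    rw [cup_cons, e, hx]
    simp [cup_cons]

theorem cup_neg_left (φ ψ : List H → A) : cup ε (-φ) ψ = -cup ε φ ψ := by
  have := cup_smul_left ε (-1 : k) φ ψ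
  simpa using this

theorem cup_sub_left (φ φ' ψ : List H → A) :
    cup ε (φ - φ') ψ = cup ε φ ψ - cup ε φ' ψ := by
  rw [sub_eq_add_neg, cup_add_left, cup_neg_left, sub_eq_add_neg]

theorem cup_add_right (φ ψ ψ' : List H → A) :
    cup ε φ (ψ + ψ') = cup ε φ ψ + cup ε φ ψ' := by
  funext l
  induction l generalizing φ with
  | nil => simp [mul_add]
  | cons x l ih => simp only [cup_cons, ih, Pi.add_apply, mul_add]; abel

theorem cup_neg_right (φ ψ : List H → A) : cup ε φ (-ψ) = -cup ε φ ψ := by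
  funext l
  induction l generalizing φ with
  | nil => simp
  | cons x l ih => simp only [cup_cons, ih, Pi.neg_apply, mul_neg, neg_add]

theorem cup_sub_right (φ ψ ψ' : List H → A) :
    cup ε φ (ψ - ψ') = cup ε φ ψ - cup ε φ ψ' := by
  rw [sub_eq_add_neg, cup_add_right, cup_neg_right, sub_eq_add_neg]

theorem act_cup (a : A) (φ ψ : List H → A) :
    cup ε (act ε a φ) ψ = act ε a (cup ε φ ψ) := by
  funext l
  induction l generalizing a φ with
  | nil => simp [act, mul_assoc]
  | cons x l ih =>
    rw [cup_cons, shift_act, ih]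
    simp [act, cup_cons, mul_add, pow_succ_apply, mul_assoc]

theorem cup_assoc (φ ψ χ : List H → A) :
    cup ε (cup ε φ ψ) χ = cup ε φ (cup ε ψ χ) := by
  funext l
  induction l generalizing φ with
  | nil => simp [mul_assoc]
  | cons x l ih =>
    rw [cup_cons, shift_cup, cup_add_left, Pi.add_apply, ih, act_cup, cup_cons, cup_cons]
    simp [act, mul_add, pow_succ_apply, mul_assoc, add_assoc]

theorem parity_cup (φ ψ : List H → A) :
    parity ε (cup ε φ ψ) = cup ε (parity ε φ) (parity ε ψ) := by
  funext l
  induction l generalizing φ with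
  | nil => simp [parity]
  | cons x l ih =>
    have h := ih (shift x φ)
    rw [cup_cons, shift_parity, cup_neg_left, Pi.neg_apply, ← h]
    simp [parity, cup_cons, pow_succ, pow_comm_apply, -zsmul_eq_mul]

/-- The extra term comes from the splitting in which the first argument belongs to `ψ`; it
disappears when `φ` vanishes in arity 0. -/
theorem cup_mulHead (φ ψ : List H → A) (x : H) :
    mulHead (cup ε φ ψ) x = cup ε (mulHead φ x) ψ + act ε (φ []) (mulHead ψ x) := by
  funext l
  cases l with
  | nil => simp [act]
  | cons y l => simp [cup_cons, act, shift_mulHead, add_comm]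

theorem cup_mulHead_of_nil {φ : List H → A} (hφ : φ [] = 0) (ψ : List H → A) (x : H) :
    mulHead (cup ε φ ψ) x = cup ε (mulHead φ x) ψ := by
  rw [cup_mulHead, hφ, zero_act, add_zero]

/-! ### Leibniz rule, Maurer–Cartan equation and the contraction by the unit. -/

section Differential

variable {ε d} (h : IsTwistedDifferential ε d)
include h

theorem IsTwistedDifferential.parity_parity (φ : List H → A) :
    parity ε (parity ε φ) = φ := by
  funext l
  simp [parity, h.invol, smul_smul, ← mul_pow, -zsmul_eq_mul]

theorem IsTwistedDifferential.barD_parity (φ : List H → A) :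
    barD d (parity ε φ) = -parity ε (barD d φ) := by
  funext l
  induction l generalizing φ with
  | nil => simp [parity, h.anticomm]
  | cons x l ih =>
    have hx := ih (shift x φ)
    rw [barD_cons, shift_parity, barD_neg, Pi.neg_apply, hx, ← parity_mulHead]
    simp [parity, barD_cons, pow_succ, smul_sub, -zsmul_eq_mul]
    abel

theorem IsTwistedDifferential.barD_act (a : A) (φ : List H → A) :
    barD d (act ε a φ) = act ε (d a) φ + act ε (ε a) (barD d φ) := by
  funext l
  induction l generalizing a φ with
  | nil => simp [act, h.leibniz]
  | cons x l ih =>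
    rw [barD_cons, shift_act, ih, ← act_mulHead]
    simp [act, barD_cons, pow_succ_apply, h.anticomm, h.invol, mul_sub]
    abel

/-- The Leibniz rule for cochains. In the inductive step, the extra term of `cup_mulHead` cancels
against the one arising from `barD_act`. -/
theorem IsTwistedDifferential.barD_cup (φ ψ : List H → A) :
    barD d (cup ε φ ψ) = cup ε (barD d φ) ψ + cup ε (parity ε φ) (barD d ψ) := by
  funext l
  induction l generalizing φ with
  | nil => simp [parity, h.leibniz]
  | cons x l ih =>
    rw [barD_cons, shift_cup, barD_add, Pi.add_apply, ih, cup_mulHead, h.barD_act]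
    simp only [Pi.add_apply, cup_cons, shift_barD, shift_parity, cup_neg_left, cup_sub_left]
    simp [act, barD_cons, pow_succ_apply, h.anticomm, h.invol, mul_sub, parity]
    abel

/-- The curvature of `τ`. -/
def curvature (ε : A →ₐ[k] A) (d : A →ₗ[k] A) (τ : List H → A) : List H → A :=
  barD d τ - cup ε (parity ε τ) τ

/-- Only `barD_barD`, the Leibniz rule and associativity are needed: the cubic terms in `τ` on the
right cancel. This identity makes the first nonzero curvature component a Hochschild cocycle. -/
theorem IsTwistedDifferential.bianchi (τ : List H → A) :
    barD d (curvature ε d τ) =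
      cup ε (parity ε (curvature ε d τ)) τ - cup ε τ (curvature ε d τ) := by
  have h1 : barD d (curvature ε d τ) = -barD d (cup ε (parity ε τ) τ) := by
    rw [curvature, barD_sub, barD_barD d h.sq_zero, zero_sub]
  rw [h1, h.barD_cup, h.parity_parity, h.barD_parity, curvature, parity_sub, cup_sub_left,
    cup_sub_right, parity_cup, h.parity_parity, cup_neg_left, ← cup_assoc]
  abel

/-- The differential on cochains twisted from the right by `τ`. -/
def twistD (ε : A →ₐ[k] A) (d : A →ₗ[k] A) (τ φ : List H → A) : List H → A :=
  barD d φ - cup ε (parity ε φ) τ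

/-- The square is right multiplication by the curvature up to sign, so flatness kills it. -/
theorem IsTwistedDifferential.twistD_twistD {τ : List H → A} (hτ : curvature ε d τ = 0)
    (φ : List H → A) : twistD ε d τ (twistD ε d τ φ) = 0 := by
  have hτ' : barD d τ = cup ε (parity ε τ) τ := sub_eq_zero.1 hτ
  simp only [twistD, barD_sub, parity_sub, cup_sub_left, barD_barD d h.sq_zero, h.barD_cup,
    h.barD_parity, h.parity_parity, parity_cup, hτ', cup_neg_left, cup_assoc]
  abel

theorem IsTwistedDifferential.twistD_act (τ : List H → A) (a : A) (φ : List H → A) :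
    twistD ε d τ (act ε a φ) = act ε (d a) φ + act ε (ε a) (twistD ε d τ φ) := by
  rw [twistD, h.barD_act, parity_act, act_cup, twistD, act_sub]
  abel

omit h

theorem twistD_self {τ : List H → A} (hτ : curvature ε d τ = 0) : twistD ε d τ τ = 0 := hτ

/-- Right multiplication by `H` commutes with the twisted differential only after arity 0 is
discarded, because of the extra term in `cup_mulHead`. This is why the matrices below use cochains
vanishing there. -/
theorem twistD_mulHead (τ : List H → A) {φ : List H → A} (hφ : φ [] = 0) (y : H) :
    twistD ε d τ (mulHead φ y) = mulHead (twistD ε d τ φ) y := by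
  rw [twistD, barD_mulHead, parity_mulHead, ← cup_mulHead_of_nil ε (by simp [parity, hφ]), twistD,
    sub_eq_add_neg, sub_eq_add_neg, mulHead_add, mulHead_neg]

theorem twistD_add (τ φ ψ : List H → A) :
    twistD ε d τ (φ + ψ) = twistD ε d τ φ + twistD ε d τ ψ := by
  simp only [twistD, barD_add, parity_add, cup_add_left]
  abel

theorem twistD_smul (c : k) (τ φ : List H → A) :
    twistD ε d τ (c • φ) = c • twistD ε d τ φ := by
  have : barD d (c • φ) = c • barD d φ := map_smul (barDₗ d) c φ
  simp only [twistD, this, parity_smul, cup_smul_left, smul_sub]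

include h

omit h

/-- Insert `1` as the first argument. -/
def insertOne (φ : List H → A) : List H → A
  | [] => 0
  | x :: l => φ (1 :: x :: l)

@[simp] theorem insertOne_nil (φ : List H → A) : insertOne φ [] = 0 := rfl

@[simp] theorem insertOne_cons (φ : List H → A) (x : H) (l : List H) :
    insertOne φ (x :: l) = φ (1 :: x :: l) := rfl

theorem shift_one_twistD (ε : A →ₐ[k] A) (d : A →ₗ[k] A) (τ : List H → A) {φ : List H → A} (hφ : φ [] = 0) :
    shift 1 (twistD ε d τ φ) = -φ - twistD ε d τ (shift 1 φ) := by
  have h1 : mulHead φ 1 = φ := by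
    funext l; cases l <;> simp [hφ]
  have h2 : shift 1 (cup ε (parity ε φ) τ) = -cup ε (parity ε (shift 1 φ)) τ := by
    rw [shift_cup, shift_parity, cup_neg_left]
    simp [parity, hφ, zero_act]
  rw [twistD, sub_eq_add_neg, shift_add, shift_neg, h2, shift_barD, h1, twistD]
  abel

/-- Inserting `1` contracts the twisted complex onto its part generated by `τ`. -/
theorem twistD_insertOne (τ : List H → A) {φ : List H → A} (hφ : φ [] = 0)
    (hD : twistD ε d τ φ = 0) :
    twistD ε d τ (insertOne φ) = -φ + mulHead (act ε (ε (φ [1])) τ) 1 := by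
  have h1 : twistD ε d τ (shift 1 φ) = -φ := by
    have := shift_one_twistD ε d τ hφ
    rw [hD] at this
    exact (sub_eq_zero.1 this.symm).symm
  -- `insertOne` forgets the arity-0 value `φ [1]` of the shifted cochain; twisting that constant
  -- produces the multiple of `τ` in the statement.
  have h2 : shift 1 φ = insertOne φ + fun l => if l = [] then φ [1] else 0 := by
    funext l; cases l <;> simp
  funext l
  cases l with
  | nil => simp [twistD, parity, hφ]
  | cons x l =>
    have h3 := congrFun h1 (x :: l)
    rw [h2, twistD_add, Pi.add_apply] at h3
    have h4 : twistD ε d τ (fun l => if l = [] then φ [1] else 0) (x :: l) =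
        -act ε (ε (φ [1])) τ (x :: l) := by
      have e1 : shift x (fun l : List H => if l = [] then φ [1] else 0) = 0 := by
        funext l; simp
      have e2 : mulHead (fun l : List H => if l = [] then φ [1] else 0) x = 0 := by
        funext l; cases l <;> simp
      have e3 : parity ε (0 : List H → A) = 0 := by
        funext l; simp [parity]
      have e4 : cup ε (0 : List H → A) τ = 0 := by
        have := cup_smul_left ε (0 : k) (0 : List H → A) τ
        simpa using this
      rw [twistD, Pi.sub_apply, barD_cons, cup_cons, e1, e2, shift_parity, e1, e3, neg_zero, e4,
        barD_zero]
      simp [parity, act]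
    rw [h4] at h3
    simp only [Pi.add_apply, mulHead_cons, one_mul]
    rw [← h3]
    abel

end Differential

end Cup

/-! ### Cochains linear in each argument. -/

section Multilinear

variable {k : Type*} [CommRing k] {H : Type*} [Ring H] [Algebra k H]
  {W : Type*} [AddCommGroup W] [Module k W] {V : Type*} [AddCommGroup V] [Module k V]

/-- A cochain that is linear in each argument. -/
def IsMulti (k : Type*) [CommRing k] {H : Type*} [Ring H] [Algebra k H]
    {W : Type*} [AddCommGroup W] [Module k W] (φ : List H → W) : Prop :=
  ∀ (l₁ l₂ : List H) (c : k) (x y : H),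
    φ (l₁ ++ (x + c • y) :: l₂) = φ (l₁ ++ x :: l₂) + c • φ (l₁ ++ y :: l₂)

theorem IsMulti.zero : IsMulti k (0 : List H → W) := fun _ _ _ _ _ => by simp

theorem IsMulti.add {φ ψ : List H → W} (hφ : IsMulti k φ) (hψ : IsMulti k ψ) :
    IsMulti k (φ + ψ) := fun l₁ l₂ c x y => by
  simp only [Pi.add_apply, hφ l₁ l₂ c x y, hψ l₁ l₂ c x y, smul_add]; abel

theorem IsMulti.smul (a : k) {φ : List H → W} (hφ : IsMulti k φ) : IsMulti k (a • φ) :=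
  fun l₁ l₂ c x y => by
  simp only [Pi.smul_apply, hφ l₁ l₂ c x y, smul_add, smul_comm c]

theorem IsMulti.neg {φ : List H → W} (hφ : IsMulti k φ) : IsMulti k (-φ) := by
  simpa using hφ.smul (-1)

theorem IsMulti.sub {φ ψ : List H → W} (hφ : IsMulti k φ) (hψ : IsMulti k ψ) :
    IsMulti k (φ - ψ) := by
  simpa [sub_eq_add_neg] using hφ.add hψ.neg

theorem IsMulti.comp (f : W →ₗ[k] V) {φ : List H → W} (hφ : IsMulti k φ) :
    IsMulti k fun l => f (φ l) := fun l₁ l₂ c x y => by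
  simp [hφ l₁ l₂ c x y]

theorem IsMulti.shift {φ : List H → W} (hφ : IsMulti k φ) (x : H) : IsMulti k (shift x φ) :=
  fun l₁ l₂ c y z => hφ (x :: l₁) l₂ c y z

theorem IsMulti.shift_linear {φ : List H → W} (hφ : IsMulti k φ) (c : k) (x y : H) :
    ListCochain.shift (x + c • y) φ = ListCochain.shift x φ + c • ListCochain.shift y φ :=
  funext fun l => hφ [] l c x y

theorem IsMulti.mulHead {φ : List H → W} (hφ : IsMulti k φ) (y : H) :
    IsMulti k (mulHead φ y) := by
  intro l₁ l₂ c x z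
  cases l₁ with
  | nil => simpa [mul_add] using hφ [] l₂ c (y * x) (y * z)
  | cons a l₁ => exact hφ (y * a :: l₁) l₂ c x z

theorem IsMulti.mulHead_linear {φ : List H → W} (hφ : IsMulti k φ) (c : k) (x y : H) :
    ListCochain.mulHead φ (x + c • y) =
      ListCochain.mulHead φ x + c • ListCochain.mulHead φ y := by
  funext l
  cases l with
  | nil => simp
  | cons a l => simpa [add_mul] using hφ [] l c (x * a) (y * a)

theorem IsMulti.barD (d : W →ₗ[k] W) {φ : List H → W} (hφ : IsMulti k φ) :
    IsMulti k (barD d φ) := by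
  intro l₁ l₂ c x y
  induction l₁ generalizing φ with
  | nil =>
    simp only [List.nil_append, barD_cons, hφ.shift_linear, hφ.mulHead_linear, barD_add_apply,
      barD_smul_apply, Pi.add_apply, Pi.smul_apply, smul_sub, smul_neg]
    abel
  | cons a l₁ ih =>
    simp only [List.cons_append, barD_cons, ih (hφ.shift a), hφ.mulHead a l₁ l₂ c x y, smul_sub,
      smul_neg]
    abel

/-- The part of a cochain in arity `n`. -/
def trunc (n : ℕ) (φ : List H → W) : List H → W := fun l => if l.length = n then φ l else 0

theorem trunc_of_length_eq {n : ℕ} (φ : List H → W) {l : List H} (h : l.length = n) :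
    trunc n φ l = φ l := if_pos h

theorem trunc_of_length_ne {n : ℕ} (φ : List H → W) {l : List H} (h : l.length ≠ n) :
    trunc n φ l = 0 := if_neg h

theorem IsMulti.trunc (n : ℕ) {φ : List H → W} (hφ : IsMulti k φ) : IsMulti k (trunc n φ) := by
  intro l₁ l₂ c x y
  simp only [ListCochain.trunc, List.length_append, List.length_cons]
  split_ifs
  · exact hφ l₁ l₂ c x y
  · simp

section Cup

variable {A : Type*} [Ring A] [Algebra k A] (ε : A →ₐ[k] A)

theorem IsMulti.act (a : A) {φ : List H → A} (hφ : IsMulti k φ) : IsMulti k (act ε a φ) := by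
  intro l₁ l₂ c x y
  simp only [ListCochain.act, List.length_append, List.length_cons, hφ l₁ l₂ c x y, mul_add,
    mul_smul_comm]

theorem IsMulti.parity {φ : List H → A} (hφ : IsMulti k φ) : IsMulti k (parity ε φ) := by
  intro l₁ l₂ c x y
  simp only [ListCochain.parity, List.length_append, List.length_cons, hφ l₁ l₂ c x y, map_add,
    map_smul, smul_add, smul_comm c]

theorem IsMulti.cup {φ ψ : List H → A} (hφ : IsMulti k φ) (hψ : IsMulti k ψ) :
    IsMulti k (cup ε φ ψ) := by
  intro l₁ l₂ c x y
  induction l₁ generalizing φ with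
  | nil =>
    have h := hψ [] l₂ c x y
    simp only [List.nil_append] at h
    simp only [List.nil_append, cup_cons, hφ.shift_linear, cup_add_left, cup_smul_left,
      h, Pi.add_apply, Pi.smul_apply, mul_add, mul_smul_comm, smul_add]
    abel
  | cons a l₁ ih =>
    have h := hψ (a :: l₁) l₂ c x y
    simp only [List.cons_append] at h
    simp only [List.cons_append, cup_cons, ih (hφ.shift a), h, mul_add, mul_smul_comm, smul_add,
      List.length_append, List.length_cons]
    abel

theorem IsMulti.insertOne {φ : List H → A} (hφ : IsMulti k φ) : IsMulti k (insertOne φ) := by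
  intro l₁ l₂ c x y
  cases l₁ with
  | nil => exact hφ [1] l₂ c x y
  | cons a l₁ => exact hφ (1 :: a :: l₁) l₂ c x y

theorem IsMulti.twistD (d : A →ₗ[k] A) {τ φ : List H → A} (hτ : IsMulti k τ) (hφ : IsMulti k φ) :
    IsMulti k (twistD ε d τ φ) :=
  (hφ.barD d).sub ((hφ.parity ε).cup ε hτ)

end Cup

end Multilinear

/-! ### Cochains of fixed total degree. -/

section Homogeneous

variable {k : Type*} [CommRing k] {H : Type*} [Ring H] [Algebra k H]
  {W : Type*} [AddCommGroup W] [Module k W] {V : Type*} [AddCommGroup V] [Module k V]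
  {𝓗 : ℤ → Submodule k H} {𝒲 : ℤ → Submodule k W} {𝒱 : ℤ → Submodule k V}

/-- A cochain of total degree `j`: in arity `n` it raises the internal degree by `j - n`. -/
def IsHomog (𝓗 : ℤ → Submodule k H) (𝒲 : ℤ → Submodule k W) (j : ℤ) (φ : List H → W) : Prop :=
  ∀ (l : List H) (p : List ℤ), List.Forall₂ (fun x n => x ∈ 𝓗 n) l p →
    φ l ∈ 𝒲 (p.sum - l.length + j)

theorem mem_of_deg_eq {i j : ℤ} {x : W} (h : x ∈ 𝒲 i) (e : i = j) : x ∈ 𝒲 j := e ▸ h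

theorem IsHomog.zero (j : ℤ) : IsHomog 𝓗 𝒲 j 0 := fun _ _ _ => zero_mem _

theorem IsHomog.add {j : ℤ} {φ ψ : List H → W} (hφ : IsHomog 𝓗 𝒲 j φ) (hψ : IsHomog 𝓗 𝒲 j ψ) :
    IsHomog 𝓗 𝒲 j (φ + ψ) := fun l p h => add_mem (hφ l p h) (hψ l p h)

theorem IsHomog.smul {j : ℤ} (c : k) {φ : List H → W} (hφ : IsHomog 𝓗 𝒲 j φ) :
    IsHomog 𝓗 𝒲 j (c • φ) := fun l p h => Submodule.smul_mem _ c (hφ l p h)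

theorem IsHomog.neg {j : ℤ} {φ : List H → W} (hφ : IsHomog 𝓗 𝒲 j φ) :
    IsHomog 𝓗 𝒲 j (-φ) := fun l p h => neg_mem (hφ l p h)

theorem IsHomog.sub {j : ℤ} {φ ψ : List H → W} (hφ : IsHomog 𝓗 𝒲 j φ) (hψ : IsHomog 𝓗 𝒲 j ψ) :
    IsHomog 𝓗 𝒲 j (φ - ψ) := fun l p h => sub_mem (hφ l p h) (hψ l p h)

theorem IsHomog.comp {j m : ℤ} (f : W →ₗ[k] V) (hf : ∀ n, ∀ x ∈ 𝒲 n, f x ∈ 𝒱 (n + m))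
    {φ : List H → W} (hφ : IsHomog 𝓗 𝒲 j φ) : IsHomog 𝓗 𝒱 (j + m) fun l => f (φ l) :=
  fun l p h => mem_of_deg_eq (hf _ _ (hφ l p h)) (by ring)

theorem IsHomog.trunc {j : ℤ} (n : ℕ) {φ : List H → W} (hφ : IsHomog 𝓗 𝒲 j φ) :
    IsHomog 𝓗 𝒲 j (trunc n φ) := by
  intro l p h
  rw [ListCochain.trunc]
  split_ifs
  · exact hφ l p h
  · exact zero_mem _

theorem IsHomog.shift {j n : ℤ} {φ : List H → W} (hφ : IsHomog 𝓗 𝒲 j φ) {x : H} (hx : x ∈ 𝓗 n) :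
    IsHomog 𝓗 𝒲 (j + n - 1) (shift x φ) := fun l p h =>
  mem_of_deg_eq (hφ (x :: l) (n :: p) (.cons hx h)) (by simp; ring)

theorem IsHomog.mulHead [GradedAlgebra 𝓗] {j n : ℤ} {φ : List H → W} (hφ : IsHomog 𝓗 𝒲 j φ)
    {y : H} (hy : y ∈ 𝓗 n) : IsHomog 𝓗 𝒲 (j + n) (mulHead φ y) := by
  intro l p h
  cases h with
  | nil => exact zero_mem _
  | @cons x m l p hx h =>
    exact mem_of_deg_eq (hφ (y * x :: l) ((n + m) :: p) (.cons (SetLike.mul_mem_graded hy hx) h))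
      (by simp; ring)

theorem IsHomog.barD [GradedAlgebra 𝓗] {d : W →ₗ[k] W} (hd : ∀ n, ∀ x ∈ 𝒲 n, d x ∈ 𝒲 (n + 1))
    {j : ℤ} {φ : List H → W} (hφ : IsHomog 𝓗 𝒲 j φ) : IsHomog 𝓗 𝒲 (j + 1) (barD d φ) := by
  intro l p h
  induction h generalizing φ j with
  | nil => exact mem_of_deg_eq (hd _ _ (hφ [] [] .nil)) (by simp)
  | @cons x m l p hx h ih =>
    rw [barD_cons]
    refine sub_mem (neg_mem (mem_of_deg_eq (hφ.mulHead hx l p h) ?_))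
      (mem_of_deg_eq (ih (hφ.shift hx)) ?_)
    · simp; ring
    · simp; ring

variable {A : Type*} [Ring A] [Algebra k A] {𝒜 : ℤ → Submodule k A} [GradedAlgebra 𝒜]
  {ε : A →ₐ[k] A}

theorem pow_mem_deg (hε : ∀ n, ∀ x ∈ 𝒜 n, ε x ∈ 𝒜 n) (m : ℕ) {n : ℤ} {x : A} (hx : x ∈ 𝒜 n) :
    (ε ^ m) x ∈ 𝒜 n := by
  induction m with
  | zero => exact hx
  | succ m ih => rw [pow_succ']; exact hε _ _ ih

theorem IsHomog.act (hε : ∀ n, ∀ x ∈ 𝒜 n, ε x ∈ 𝒜 n) {i j : ℤ} {a : A} (ha : a ∈ 𝒜 i)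
    {φ : List H → A} (hφ : IsHomog 𝓗 𝒜 j φ) : IsHomog 𝓗 𝒜 (i + j) (act ε a φ) := fun l p h =>
  mem_of_deg_eq (SetLike.mul_mem_graded (pow_mem_deg hε l.length ha) (hφ l p h)) (by ring)

theorem IsHomog.parity (hε : ∀ n, ∀ x ∈ 𝒜 n, ε x ∈ 𝒜 n) {j : ℤ}
    {φ : List H → A} (hφ : IsHomog 𝓗 𝒜 j φ) : IsHomog 𝓗 𝒜 j (parity ε φ) := fun l p h =>
  zsmul_mem (hε _ _ (hφ l p h)) _

theorem IsHomog.cup (hε : ∀ n, ∀ x ∈ 𝒜 n, ε x ∈ 𝒜 n) {i j : ℤ} {φ ψ : List H → A}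
    (hφ : IsHomog 𝓗 𝒜 i φ) (hψ : IsHomog 𝓗 𝒜 j ψ) : IsHomog 𝓗 𝒜 (i + j) (cup ε φ ψ) := by
  intro l p h
  induction h generalizing φ i with
  | nil =>
    exact mem_of_deg_eq (SetLike.mul_mem_graded (hφ [] [] .nil) (hψ [] [] .nil)) (by simp)
  | @cons x m l p hx h ih =>
    rw [cup_cons]
    refine add_mem (mem_of_deg_eq (SetLike.mul_mem_graded
      (pow_mem_deg hε _ (hφ [] [] .nil)) (hψ _ _ (.cons hx h))) ?_)
      (mem_of_deg_eq (ih (hφ.shift hx)) ?_)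
    · simp; ring
    · simp; ring

theorem IsHomog.insertOne [GradedAlgebra 𝓗] {j : ℤ} {φ : List H → A} (hφ : IsHomog 𝓗 𝒜 j φ) :
    IsHomog 𝓗 𝒜 (j - 1) (insertOne φ) := by
  intro l p h
  cases h with
  | nil => exact zero_mem _
  | @cons x m l p hx h =>
    exact mem_of_deg_eq
      (hφ (1 :: x :: l) (0 :: m :: p) (.cons (SetLike.one_mem_graded 𝓗) (.cons hx h)))
      (by simp; ring)

theorem IsHomog.twistD [GradedAlgebra 𝓗] (hε : ∀ n, ∀ x ∈ 𝒜 n, ε x ∈ 𝒜 n) {d : A →ₗ[k] A}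
    (hd : ∀ n, ∀ x ∈ 𝒜 n, d x ∈ 𝒜 (n + 1)) {j : ℤ} {τ φ : List H → A} (hτ : IsHomog 𝓗 𝒜 1 τ)
    (hφ : IsHomog 𝓗 𝒜 j φ) : IsHomog 𝓗 𝒜 (j + 1) (twistD ε d τ φ) :=
  (hφ.barD hd).sub ((hφ.parity hε).cup hε hτ)

end Homogeneous

end ListCochain

namespace DGA

open ListCochain

variable {k : Type u} [CommRing k]

/-! ### The parity automorphism and Koszul signs. -/

section Sign

variable {H : Type*} [Ring H] [Algebra k H] (𝓗 : ℤ → Submodule k H) [GradedAlgebra 𝓗]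

/-- The parity automorphism `x ↦ (-1) ^ |x| x` of a graded algebra. -/
noncomputable def signHom : H →ₐ[k] H :=
  AlgHom.ofLinearMap (koszulSign 𝓗 1)
    (by rw [koszulSign_of_mem 𝓗 1 (SetLike.one_mem_graded 𝓗)]; simp)
    (by
      intro x y
      induction x using DirectSum.Decomposition.inductionOn 𝓗 with
      | zero => simp
      | add x x' hx hx' => simp [add_mul, hx, hx']
      | @homogeneous i x =>
        induction y using DirectSum.Decomposition.inductionOn 𝓗 with
        | zero => simp
        | add y y' hy hy' => simp [mul_add, hy, hy']
        | @homogeneous j y =>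
          rw [koszulSign_of_mem 𝓗 1 x.2, koszulSign_of_mem 𝓗 1 y.2,
            koszulSign_of_mem 𝓗 1 (SetLike.mul_mem_graded x.2 y.2), smul_mul_smul_comm]
          simp [Int.negOnePow_add])

theorem signHom_of_mem {n : ℤ} {x : H} (hx : x ∈ 𝓗 n) :
    signHom 𝓗 x = (n.negOnePow : ℤ) • x := by
  have := koszulSign_of_mem 𝓗 1 hx
  rwa [one_mul] at this

theorem signHom_mem {n : ℤ} {x : H} (hx : x ∈ 𝓗 n) : signHom 𝓗 x ∈ 𝓗 n := by
  rw [signHom_of_mem 𝓗 hx]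
  exact zsmul_mem hx _

theorem signHom_signHom (x : H) : signHom 𝓗 (signHom 𝓗 x) = x := by
  induction x using DirectSum.Decomposition.inductionOn 𝓗 with
  | zero => simp
  | add x x' hx hx' => simp [hx, hx']
  | homogeneous x =>
    rw [signHom_of_mem 𝓗 x.2, map_zsmul, signHom_of_mem 𝓗 x.2, smul_smul, ← Units.val_mul,
      Int.units_mul_self, Units.val_one, one_smul]

/-- Matches the powers of the parity operator in `cup` with the Koszul sign in the Hochschild
differential. -/
theorem signHom_pow_apply (m : ℕ) (x : H) : (signHom 𝓗 ^ m) x = koszulSign 𝓗 m x := by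
  induction x using DirectSum.Decomposition.inductionOn 𝓗 with
  | zero => simp
  | add x x' hx hx' => simp only [map_add, hx, hx']
  | @homogeneous n x =>
    rw [koszulSign_of_mem 𝓗 m x.2]
    induction m with
    | zero => simp
    | succ m ih =>
      rw [pow_succ_apply, signHom_of_mem 𝓗 x.2, map_zsmul, ih, smul_smul, ← Units.val_mul,
        ← Int.negOnePow_add]
      congr 3
      push_cast
      ring

theorem koszulSign_congr {m m' : ℤ} (h : Even (m - m')) : koszulSign 𝓗 m = koszulSign 𝓗 m' := by
  ext x
  induction x using DirectSum.Decomposition.inductionOn 𝓗 with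
  | zero => simp
  | add x x' hx hx' => simp only [map_add, hx, hx']
  | @homogeneous n x =>
    rw [koszulSign_of_mem 𝓗 m x.2, koszulSign_of_mem 𝓗 m' x.2]
    congr 2
    rw [← sub_add_cancel m m', add_mul, Int.negOnePow_add,
      Int.negOnePow_even _ (h.mul_right n), one_mul]

end Sign

/-- The parity automorphism absorbs the sign of the graded Leibniz rule, which then holds for
inhomogeneous elements too. -/
theorem isTwistedDifferential (A : DGA.{u, v} k) :
    IsTwistedDifferential (signHom A.deg) A.d where
  invol := signHom_signHom A.deg
  anticomm a := by
    induction a using DirectSum.Decomposition.inductionOn A.deg with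
    | zero => simp
    | add x x' hx hx' => simp only [map_add, hx, hx', neg_add]
    | homogeneous x =>
      rw [signHom_of_mem _ x.2, map_zsmul, signHom_of_mem _ (A.d_mem x.2), Int.negOnePow_succ]
      simp
  sq_zero := A.d_d
  leibniz a b := by
    induction a using DirectSum.Decomposition.inductionOn A.deg with
    | zero => simp
    | add x x' hx hx' => simp only [map_add, add_mul, hx, hx']; abel
    | homogeneous x => rw [A.d_mul x.2, signHom_of_mem _ x.2, smul_mul_assoc]

/-! ### A dga from homogeneous pieces that need not span the ambient algebra. -/

section OfGraded

variable {R : Type v} [Ring R] [Algebra k R] (𝒯 : ℤ → Submodule k R) [SetLike.GradedMonoid 𝒯]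

/-- The degree `n` part of the external direct sum of a graded family of submodules. -/
noncomputable def sumDeg (n : ℤ) : Submodule k (⨁ n, 𝒯 n) :=
  LinearMap.range (DirectSum.lof k ℤ (fun i => 𝒯 i) n)

/-- The inclusion of `𝒯 n`, as a map to the degree `n` part. -/
noncomputable def toSumDeg (n : ℤ) : 𝒯 n →ₗ[k] sumDeg 𝒯 n :=
  (DirectSum.lof k ℤ (fun i => 𝒯 i) n).codRestrict (sumDeg 𝒯 n) fun x => ⟨x, rfl⟩

noncomputable instance : GradedAlgebra (sumDeg 𝒯) where
  one_mem := ⟨⟨1, SetLike.one_mem_graded 𝒯⟩, rfl⟩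
  mul_mem := by
    rintro i j _ _ ⟨x, rfl⟩ ⟨y, rfl⟩
    exact ⟨GradedMonoid.GMul.mul (A := fun i => 𝒯 i) x y,
      (DirectSum.of_mul_of (A := fun i => 𝒯 i) x y).symm⟩
  toDecomposition := DirectSum.Decomposition.ofLinearMap (sumDeg 𝒯)
    (DirectSum.toModule k ℤ _ fun n =>
      DirectSum.lof k ℤ (fun i => sumDeg 𝒯 i) n ∘ₗ toSumDeg 𝒯 n)
    (by
      refine DirectSum.linearMap_ext k fun n => LinearMap.ext fun x => ?_
      simp only [LinearMap.comp_apply, DirectSum.toModule_lof]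
      exact DirectSum.coeLinearMap_lof (sumDeg 𝒯) n (toSumDeg 𝒯 n x))
    (by
      refine DirectSum.linearMap_ext k fun n => LinearMap.ext fun x => ?_
      obtain ⟨_, y, rfl⟩ := x
      simp only [LinearMap.comp_apply, DirectSum.coeLinearMap_lof, DirectSum.toModule_lof]
      rfl)

theorem of_congr {i j : ℤ} (h : i = j) {x : R} (hi : x ∈ 𝒯 i) (hj : x ∈ 𝒯 j) :
    DirectSum.of (fun n => 𝒯 n) i ⟨x, hi⟩ = DirectSum.of (fun n => 𝒯 n) j ⟨x, hj⟩ := by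
  subst h; rfl

variable {𝒯} {D : R →ₗ[k] R} (hD : ∀ n, ∀ x ∈ 𝒯 n, D x ∈ 𝒯 (n + 1))

/-- The differential induced on the external direct sum. -/
noncomputable def sumD : (⨁ n, 𝒯 n) →ₗ[k] ⨁ n, 𝒯 n :=
  DirectSum.toModule k ℤ _ fun n =>
    DirectSum.lof k ℤ (fun i => 𝒯 i) (n + 1) ∘ₗ D.restrict (hD n)

theorem sumD_of {n : ℤ} (x : 𝒯 n) :
    sumD hD (DirectSum.of (fun n => 𝒯 n) n x) =
      DirectSum.of (fun n => 𝒯 n) (n + 1) ⟨D x, hD n x x.2⟩ :=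
  DirectSum.toModule_lof (M := fun i => 𝒯 i) k n x

variable (hDD : ∀ n, ∀ x ∈ 𝒯 n, D (D x) = 0)
  (hmul : ∀ n, ∀ x ∈ 𝒯 n, ∀ m, ∀ y ∈ 𝒯 m, D (x * y) = D x * y + (n.negOnePow : ℤ) • (x * D y))

/-- The dga with homogeneous parts `𝒯 n`, for a graded family of submodules of an algebra that is
stable under a differential. -/
noncomputable def ofGraded : DGA.{u, v} k where
  carrier := ⨁ n, 𝒯 n
  deg := sumDeg 𝒯
  d := sumD hD
  d_mem := by
    rintro n _ ⟨x, rfl⟩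
    exact ⟨⟨D x, hD n x x.2⟩, (sumD_of hD x).symm⟩
  d_d x := by
    induction x using DirectSum.induction_on with
    | zero => simp
    | add x y hx hy => simp [hx, hy]
    | of n x =>
      rw [sumD_of, sumD_of]
      simp only [hDD n x x.2]
      exact map_zero (DirectSum.of (fun n => 𝒯 n) (n + 1 + 1))
  d_mul := by
    rintro n _ ⟨x, rfl⟩ y
    change sumD hD (DirectSum.of (fun n => 𝒯 n) n x * y) =
      sumD hD (DirectSum.of (fun n => 𝒯 n) n x) * y +
        (n.negOnePow : ℤ) • (DirectSum.of (fun n => 𝒯 n) n x * sumD hD y)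
    induction y using DirectSum.induction_on with
    | zero => simp
    | add y z hy hz => simp only [mul_add, map_add, hy, hz, smul_add]; abel
    | of m y =>
      have h1 : D (x * y) ∈ 𝒯 (n + m + 1) := hD _ _ (SetLike.mul_mem_graded x.2 y.2)
      have h2 : D x * y ∈ 𝒯 (n + 1 + m) := SetLike.mul_mem_graded (hD n x x.2) y.2
      have h3 : (x : R) * D y ∈ 𝒯 (n + (m + 1)) := SetLike.mul_mem_graded x.2 (hD m y y.2)
      have e2 : n + 1 + m = n + m + 1 := by ring
      have e3 : n + (m + 1) = n + m + 1 := by ring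
      rw [sumD_of, sumD_of, DirectSum.of_mul_of, DirectSum.of_mul_of, DirectSum.of_mul_of, sumD_of]
      change DirectSum.of (fun n => 𝒯 n) (n + m + 1) ⟨D (x * y), h1⟩ =
        DirectSum.of (fun n => 𝒯 n) (n + 1 + m) ⟨D x * y, h2⟩ +
          (n.negOnePow : ℤ) • DirectSum.of (fun n => 𝒯 n) (n + (m + 1)) ⟨x * D y, h3⟩
      rw [of_congr 𝒯 e2 h2 (e2 ▸ h2), of_congr 𝒯 e3 h3 (e3 ▸ h3)]
      refine Eq.trans ?_ (congrArg (fun t => DirectSum.of (fun n => 𝒯 n) (n + m + 1)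
        ⟨D x * y, e2 ▸ h2⟩ + t) (map_zsmul (DirectSum.of (fun n => 𝒯 n) (n + m + 1))
          (n.negOnePow : ℤ) ⟨x * D y, e3 ▸ h3⟩))
      rw [← map_add]
      congr 1
      ext
      exact hmul n x x.2 m y y.2

/-- A graded algebra map out of the ambient algebra of `ofGraded` induces a morphism of dgas. -/
noncomputable def ofGradedHom (B : DGA.{u, v} k) (f : R →ₐ[k] B.carrier)
    (hf : ∀ n, ∀ x ∈ 𝒯 n, f x ∈ B.deg n) (hfD : ∀ n, ∀ x ∈ 𝒯 n, f (D x) = B.d (f x)) :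
    Hom (ofGraded hD hDD hmul) B where
  toAlgHom := f.comp (DirectSum.coeAlgHom 𝒯)
  map_deg := by
    rintro n _ ⟨x, rfl⟩
    have : DirectSum.coeAlgHom 𝒯 (DirectSum.lof k ℤ (fun i => 𝒯 i) n x) = x :=
      DirectSum.coeAlgHom_of 𝒯 n x
    change f (DirectSum.coeAlgHom 𝒯 (DirectSum.lof k ℤ (fun i => 𝒯 i) n x)) ∈ B.deg n
    rw [this]
    exact hf n x x.2
  map_d x := by
    change f (DirectSum.coeAlgHom 𝒯 (sumD hD x)) = B.d (f (DirectSum.coeAlgHom 𝒯 x))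
    induction x using DirectSum.induction_on with
    | zero => simp
    | add x y hx hy => simp only [map_add, hx, hy]
    | of n x =>
      rw [sumD_of, DirectSum.coeAlgHom_of, DirectSum.coeAlgHom_of]
      exact hfD n x x.2

end OfGraded

/-! ### Testing quasi-isomorphisms degree by degree. -/

section QuasiIso

variable {A : DGA.{u, v} k} {B : DGA.{u, w} k} (f : Hom A B)

theorem decompose_map (x : A.carrier) (n : ℤ) :
    (DirectSum.decompose B.deg (f.toAlgHom x) n : B.carrier) =
      f.toAlgHom (DirectSum.decompose A.deg x n) := by
  induction x using DirectSum.Decomposition.inductionOn A.deg with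
  | zero => simp
  | add x y hx hy => simp [DirectSum.decompose_add, hx, hy]
  | @homogeneous i m =>
    by_cases h : i = n
    · subst h
      rw [DirectSum.decompose_of_mem_same _ m.2, DirectSum.decompose_of_mem_same _ (f.map_deg m.2)]
    · rw [DirectSum.decompose_of_mem_ne _ m.2 h, DirectSum.decompose_of_mem_ne _ (f.map_deg m.2) h,
        map_zero]

theorem homologyMap_toHomology (z : A.cocycles) :
    f.homologyMap (A.toHomology z) = B.toHomology (f.cocyclesMap z) := rfl

/-- Quasi-isomorphisms can be tested on homogeneous cocycles. -/
theorem isQuasiIso_of_homogeneous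
    (inj : ∀ (n : ℤ) (x : A.carrier), x ∈ A.deg n → A.d x = 0 →
      (∃ b, B.d b = f.toAlgHom x) → ∃ y, A.d y = x)
    (surj : ∀ (n : ℤ) (b : B.carrier), b ∈ B.deg n → B.d b = 0 →
      ∃ a, A.d a = 0 ∧ ∃ c, B.d c = f.toAlgHom a - b) : f.IsQuasiIso := by
  classical
  constructor
  · rw [injective_iff_map_eq_zero]
    intro x hx
    obtain ⟨z, rfl⟩ := A.toHomology_surjective x
    rw [homologyMap_toHomology, B.toHomology_eq_zero] at hx
    obtain ⟨b, hb⟩ := hx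
    have hb' : B.d b = f.toAlgHom z := hb
    have key : ∀ n, ∃ y, A.d y = DirectSum.decompose A.deg (z : A.carrier) n := by
      intro n
      refine inj n _ (SetLike.coe_mem _) (A.d_coe_cocycles (A.cocycleProj n z))
        ⟨DirectSum.decompose B.deg b (n - 1), ?_⟩
      rw [d_decompose, hb', decompose_map, sub_add_cancel]
    choose y hy using key
    refine A.toHomology_eq_zero.2
      ⟨∑ n ∈ (DirectSum.decompose A.deg (z : A.carrier)).support, y n, ?_⟩
    rw [map_sum, Finset.sum_congr rfl fun n _ => hy n]
    exact DirectSum.sum_support_decompose A.deg (z : A.carrier)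
  · intro x
    obtain ⟨z, rfl⟩ := B.toHomology_surjective x
    have key : ∀ n, ∃ a, A.d a = 0 ∧
        ∃ c, B.d c = f.toAlgHom a - DirectSum.decompose B.deg (z : B.carrier) n := fun n =>
      surj n _ (SetLike.coe_mem _) (B.d_coe_cocycles (B.cocycleProj n z))
    choose a ha c hc using key
    refine ⟨A.toHomology (∑ n ∈ (DirectSum.decompose B.deg (z : B.carrier)).support,
      ⟨a n, ha n⟩), ?_⟩
    rw [homologyMap_toHomology, ← sub_eq_zero, ← map_sub, B.toHomology_eq_zero]
    refine ⟨∑ n ∈ (DirectSum.decompose B.deg (z : B.carrier)).support, c n, ?_⟩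
    rw [map_sum, Finset.sum_congr rfl fun n _ => hc n, Finset.sum_sub_distrib,
      DirectSum.sum_support_decompose B.deg (z : B.carrier)]
    simp [Hom.cocyclesMap]

end QuasiIso

/-- A graded algebra, as a dga with zero differential. -/
def ofGradedAlgebra {H : Type v} [Ring H] [Algebra k H] (𝓗 : ℤ → Submodule k H)
    [GradedAlgebra 𝓗] : DGA.{u, v} k where
  carrier := H
  deg := 𝓗
  d := 0
  d_mem _ := zero_mem _
  d_d _ := rfl
  d_mul _ _ := by simp

/-! ### The dga of triangular matrices. -/

section Triangular

variable (A : DGA.{u, v} k) (H : Type v) [Ring H] [Algebra k H]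

/-- The multilinear cochains that vanish in arity `0`. -/
def multiCochains : Submodule k (List H → A.carrier) where
  carrier := {φ | IsMulti k φ ∧ φ [] = 0}
  add_mem' h h' := ⟨h.1.add h'.1, by simp [h.2, h'.2]⟩
  zero_mem' := ⟨.zero, rfl⟩
  smul_mem' c _ h := ⟨h.1.smul c, by simp [h.2]⟩

/-- The algebra of triangular matrices with diagonal entries in `A` and `H`, whose off-diagonal
entries are the multilinear cochains that vanish in arity `0`. -/
def Triangular : Type v := A.carrier × multiCochains A H × H

namespace Triangular

noncomputable instance : AddCommGroup (Triangular A H) :=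
  inferInstanceAs (AddCommGroup (A.carrier × multiCochains A H × H))

noncomputable instance : Module k (Triangular A H) :=
  inferInstanceAs (Module k (A.carrier × multiCochains A H × H))

variable {A H}

/-- The off-diagonal entry. -/
def cochain (t : Triangular A H) : List H → A.carrier := t.2.1

@[ext] theorem ext {s t : Triangular A H} (h₁ : s.1 = t.1) (h₂ : s.cochain = t.cochain)
    (h₃ : s.2.2 = t.2.2) : s = t :=
  Prod.ext h₁ (Prod.ext (Subtype.ext h₂) h₃)

theorem cochain_multi (t : Triangular A H) : IsMulti k t.cochain := t.2.1.2.1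

@[simp] theorem cochain_nil (t : Triangular A H) : t.cochain [] = 0 := t.2.1.2.2

@[simp] theorem fst_add (s t : Triangular A H) : (s + t).1 = s.1 + t.1 := rfl
@[simp] theorem cochain_add (s t : Triangular A H) :
    (s + t).cochain = s.cochain + t.cochain := rfl
@[simp] theorem snd_add (s t : Triangular A H) : (s + t).2.2 = s.2.2 + t.2.2 := rfl
@[simp] theorem fst_smul (c : k) (t : Triangular A H) : (c • t).1 = c • t.1 := rfl
@[simp] theorem cochain_smul (c : k) (t : Triangular A H) :
    (c • t).cochain = c • t.cochain := rfl
@[simp] theorem snd_smul (c : k) (t : Triangular A H) : (c • t).2.2 = c • t.2.2 := rfl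
@[simp] theorem fst_zero : (0 : Triangular A H).1 = 0 := rfl
@[simp] theorem cochain_zero : (0 : Triangular A H).cochain = 0 := rfl
@[simp] theorem snd_zero : (0 : Triangular A H).2.2 = 0 := rfl

theorem mulHead_one {φ : List H → A.carrier} (h : φ [] = 0) : mulHead φ 1 = φ := by
  funext l; cases l <;> simp [h]

theorem mulHead_add_right {φ : List H → A.carrier} (h : IsMulti k φ) (x y : H) :
    mulHead φ (x + y) = mulHead φ x + mulHead φ y := by
  simpa using h.mulHead_linear 1 x y

theorem mulHead_zero_right {φ : List H → A.carrier} (h : IsMulti k φ) : mulHead φ 0 = 0 := by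
  simpa using mulHead_add_right h 0 0

theorem mulHead_smul_right {φ : List H → A.carrier} (h : IsMulti k φ) (c : k) (y : H) :
    mulHead φ (c • y) = c • mulHead φ y := by
  simpa [mulHead_zero_right h] using h.mulHead_linear c 0 y

theorem mulHead_zero_left (y : H) : mulHead (0 : List H → A.carrier) y = 0 := by
  funext l; cases l <;> rfl

/-- Matrix multiplication for the bimodule of cochains: `A` acts on values from the left, `H` on the
first argument, which is a right action. The unit of `H` acts as the identity because arity 0 is
zero. -/
noncomputable instance : Mul (Triangular A H) where
  mul s t := (s.1 * t.1,
    ⟨act (signHom A.deg) s.1 t.cochain + mulHead s.cochain t.2.2,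
      (t.cochain_multi.act _ _).add (s.cochain_multi.mulHead _), by simp [act]⟩,
    s.2.2 * t.2.2)

instance : One (Triangular A H) where
  one := (1, 0, 1)

@[simp] theorem fst_mul (s t : Triangular A H) : (s * t).1 = s.1 * t.1 := rfl
@[simp] theorem cochain_mul (s t : Triangular A H) : (s * t).cochain =
    act (signHom A.deg) s.1 t.cochain + mulHead s.cochain t.2.2 := rfl
@[simp] theorem snd_mul (s t : Triangular A H) : (s * t).2.2 = s.2.2 * t.2.2 := rfl
@[simp] theorem fst_one : (1 : Triangular A H).1 = 1 := rfl
@[simp] theorem cochain_one : (1 : Triangular A H).cochain = 0 := rfl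
@[simp] theorem snd_one : (1 : Triangular A H).2.2 = 1 := rfl

noncomputable instance : Ring (Triangular A H) :=
  { (inferInstance : AddCommGroup (Triangular A H)),
    (inferInstance : Mul (Triangular A H)), (inferInstance : One (Triangular A H)) with
    left_distrib := fun r s t => by
      ext1
      · simp [mul_add]
      · simp only [cochain_mul, cochain_add, snd_add, act_add,
          mulHead_add_right r.cochain_multi]
        abel
      · simp [mul_add]
    right_distrib := fun r s t => by
      ext1
      · simp [add_mul]
      · simp only [cochain_mul, cochain_add, fst_add, add_act, mulHead_add]
        abel
      · simp [add_mul]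
    zero_mul := fun t => by
      ext1
      · simp
      · simp [zero_act, mulHead_zero_left]
      · simp
    mul_zero := fun t => by
      ext1
      · simp
      · simp [act_zero, mulHead_zero_right t.cochain_multi]
      · simp
    mul_assoc := fun r s t => by
      ext1
      · simp [mul_assoc]
      · simp only [cochain_mul, fst_mul, snd_mul, mul_act, mulHead_add, act_add, mulHead_mulHead,
          act_mulHead, add_assoc]
      · simp [mul_assoc]
    one_mul := fun t => by
      ext1
      · simp
      · simp [one_act, mulHead_zero_left]
      · simp
    mul_one := fun t => by
      ext1
      · simp
      · simp [act_zero, mulHead_one t.cochain_nil]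
      · simp
    zsmul := fun n t => n • t
    zsmul_zero' := SubNegMonoid.zsmul_zero'
    zsmul_succ' := SubNegMonoid.zsmul_succ'
    zsmul_neg' := SubNegMonoid.zsmul_neg'
    nsmul := fun n t => n • t
    nsmul_zero := AddMonoid.nsmul_zero
    nsmul_succ := AddMonoid.nsmul_succ
    neg_add_cancel := neg_add_cancel
    sub_eq_add_neg := sub_eq_add_neg }

noncomputable instance : Algebra k (Triangular A H) :=
  Algebra.ofModule
    (fun c s t => by
      ext1
      · simp
      · have e := mulHead_smul c s.cochain t.2.2
        rw [cochain_mul, cochain_smul, cochain_smul, e, fst_smul, smul_act, cochain_mul, smul_add]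
      · simp)
    (fun c s t => by
      ext1
      · simp
      · simp only [cochain_mul, cochain_smul, snd_smul, act_smul,
          mulHead_smul_right s.cochain_multi, smul_add]
      · simp)

variable (A H) in
/-- The projection to the upper left entry. -/
noncomputable def fstHom : Triangular A H →ₐ[k] A.carrier :=
  AlgHom.ofLinearMap (LinearMap.fst k A.carrier (multiCochains A H × H)) rfl fun _ _ => rfl

variable (A H) in
/-- The projection to the lower right entry. -/
noncomputable def sndHom : Triangular A H →ₐ[k] H :=
  AlgHom.ofLinearMap (LinearMap.snd k (multiCochains A H) H ∘ₗ
    LinearMap.snd k A.carrier (multiCochains A H × H)) rfl fun _ _ => rfl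

theorem fst_zsmul (n : ℤ) (t : Triangular A H) : (n • t).1 = n • t.1 :=
  map_zsmul (fstHom A H) n t

variable (A H) in
/-- The off-diagonal entry, as a linear map. -/
noncomputable def cochainₗ : Triangular A H →ₗ[k] (List H → A.carrier) where
  toFun := cochain
  map_add' _ _ := rfl
  map_smul' _ _ := rfl

theorem cochain_zsmul (n : ℤ) (t : Triangular A H) : (n • t).cochain = n • t.cochain :=
  map_zsmul (cochainₗ A H) n t

/-- The homogeneous elements of degree `n`. -/
def degree (A : DGA.{u, v} k) {H : Type v} [Ring H] [Algebra k H] (𝓗 : ℤ → Submodule k H)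
    (n : ℤ) : Submodule k (Triangular A H) where
  carrier := {t | t.1 ∈ A.deg n ∧ IsHomog 𝓗 A.deg n t.cochain ∧ t.2.2 ∈ 𝓗 n}
  add_mem' h h' := ⟨add_mem h.1 h'.1, h.2.1.add h'.2.1, add_mem h.2.2 h'.2.2⟩
  zero_mem' := ⟨zero_mem _, .zero n, zero_mem _⟩
  smul_mem' c _ h := ⟨Submodule.smul_mem _ c h.1, h.2.1.smul c, Submodule.smul_mem _ c h.2.2⟩

variable {𝓗 : ℤ → Submodule k H} [GradedAlgebra 𝓗]

/-- There is no decomposition in general: a cochain can have components in infinitely many degrees.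
Hence the passage to the external direct sum in `ofGraded`. -/
instance : SetLike.GradedMonoid (degree A 𝓗) where
  one_mem := ⟨SetLike.one_mem_graded A.deg, .zero 0, SetLike.one_mem_graded 𝓗⟩
  mul_mem _ _ _ _ h h' := ⟨SetLike.mul_mem_graded h.1 h'.1,
    (IsHomog.act (𝒜 := A.deg) (fun _ _ => signHom_mem A.deg) h.1 h'.2.1).add (h.2.1.mulHead h'.2.2),
    SetLike.mul_mem_graded h.2.2 h'.2.2⟩

/-- The differential on triangular matrices, twisted by the matrix with off-diagonal entry `τ`. -/
noncomputable def D {τ : List H → A.carrier} (hτ : IsMulti k τ) (hτ₀ : τ [] = 0) :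
    Triangular A H →ₗ[k] Triangular A H where
  toFun t := (A.d t.1,
    ⟨twistD (signHom A.deg) A.d τ t.cochain + mulHead τ t.2.2 - act (signHom A.deg)
        (signHom A.deg t.1) τ,
      ((IsMulti.twistD (signHom A.deg) A.d hτ t.cochain_multi).add (hτ.mulHead t.2.2)).sub
        (hτ.act (signHom A.deg) (signHom A.deg t.1)), by
        simp [twistD, act, hτ₀]⟩, 0)
  map_add' s t := by
    ext1
    · exact map_add A.d _ _
    · change twistD _ _ _ _ + mulHead _ _ - act _ _ _ = (twistD _ _ _ _ + mulHead _ _ - act _ _ _)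
        + (twistD _ _ _ _ + mulHead _ _ - act _ _ _)
      simp only [cochain_add, fst_add, snd_add, twistD_add, mulHead_add_right hτ, map_add, add_act]
      abel
    · exact (add_zero 0).symm
  map_smul' c t := by
    ext1
    · exact map_smul A.d _ _
    · change twistD _ _ _ _ + mulHead _ _ - act _ _ _ =
        c • (twistD _ _ _ _ + mulHead _ _ - act _ _ _)
      simp only [cochain_smul, fst_smul, snd_smul, twistD_smul, mulHead_smul_right hτ, map_smul,
        smul_act, smul_sub, smul_add]
    · exact (smul_zero c).symm

variable {τ : List H → A.carrier} (hτ : IsMulti k τ) (hτ₀ : τ [] = 0)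

@[simp] theorem fst_D (t : Triangular A H) : (D hτ hτ₀ t).1 = A.d t.1 := rfl

@[simp] theorem cochain_D (t : Triangular A H) : (D hτ hτ₀ t).cochain =
    twistD (signHom A.deg) A.d τ t.cochain + mulHead τ t.2.2 - act (signHom A.deg)
        (signHom A.deg t.1) τ := rfl

@[simp] theorem snd_D (t : Triangular A H) : (D hτ hτ₀ t).2.2 = 0 := rfl

theorem D_mem (hτ₁ : IsHomog 𝓗 A.deg 1 τ) (n : ℤ) (t : Triangular A H) (ht : t ∈ degree A 𝓗 n) :
    D hτ hτ₀ t ∈ degree A 𝓗 (n + 1) := by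
  refine ⟨A.d_mem ht.1, ?_, zero_mem _⟩
  rw [cochain_D]
  refine ((IsHomog.twistD (𝒜 := A.deg) (fun _ _ => signHom_mem A.deg) (fun _ _ => A.d_mem) hτ₁ ht.2.1).add
    ?_).sub ?_
  · rw [add_comm]
    exact hτ₁.mulHead ht.2.2
  · exact IsHomog.act (𝒜 := A.deg) (fun _ _ => signHom_mem A.deg) (signHom_mem A.deg ht.1) hτ₁

theorem twistD_sub (φ ψ : List H → A.carrier) :
    twistD (signHom A.deg) A.d τ (φ - ψ) =
      twistD (signHom A.deg) A.d τ φ - twistD (signHom A.deg) A.d τ ψ := by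
  have := twistD_smul (ε := signHom A.deg) (d := A.d) (-1 : k) τ ψ
  rw [sub_eq_add_neg, twistD_add, ← neg_one_smul k ψ, this, neg_one_smul, sub_eq_add_neg]

/-- Flatness gives both a square-zero twisted differential and `twistD_self`, which leaves from the
two diagonal contributions only cancelling multiples of `τ`. -/
theorem D_D (hτF : curvature (signHom A.deg) A.d τ = 0) (t : Triangular A H) :
    D hτ hτ₀ (D hτ hτ₀ t) = 0 := by
  have hA := A.isTwistedDifferential
  ext1
  · simp [A.d_d]
  · rw [cochain_D, cochain_D, fst_D, snd_D, mulHead_zero_right hτ, twistD_sub, twistD_add,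
      hA.twistD_twistD hτF, hA.twistD_act, twistD_mulHead τ hτ₀, twistD_self hτF, act_zero,
      mulHead_zero_left, hA.anticomm, neg_act]
    simp
  · simp

theorem D_mul (n : ℤ) (s : Triangular A H) (hs : s.1 ∈ A.deg n) (t : Triangular A H) :
    D hτ hτ₀ (s * t) = D hτ hτ₀ s * t + (n.negOnePow : ℤ) • (s * D hτ hτ₀ t) := by
  have hA := A.isTwistedDifferential
  have hz : ∀ φ : List H → A.carrier, (n.negOnePow : ℤ) • act (signHom A.deg) s.1 φ =
      act (signHom A.deg) (signHom A.deg s.1) φ := by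
    intro φ
    rw [signHom_of_mem A.deg hs]
    funext l
    simp [act, -zsmul_eq_mul]
  ext1
  · simp only [fst_D, fst_mul, fst_add, fst_zsmul, A.d_mul hs]
  · rw [cochain_add, cochain_zsmul, cochain_mul s, snd_D, mulHead_zero_right s.cochain_multi,
      add_zero, hz]
    simp only [cochain_D, cochain_mul, fst_D, fst_mul, snd_mul, twistD_add, hA.twistD_act,
      twistD_mulHead τ s.cochain_nil, map_mul, mul_act, act_add, act_neg, mulHead_add,
      mulHead_mulHead, sub_eq_add_neg, mulHead_neg, act_mulHead]
    abel
  · simp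

end Triangular

end Triangular

/-! ### Cocycles representing elements of a fixed homology algebra. -/

/-- An identification of the homology algebra of `A` with the graded algebra `H`. -/
structure HomologyModel (A : DGA.{u, v} k) {H : Type v} [Ring H] [Algebra k H]
    (𝓗 : ℤ → Submodule k H) where
  π : A.cocycles →ₐ[k] H
  exists_cocycle : ∀ (n : ℤ) (x : H), x ∈ 𝓗 n →
    ∃ z : A.cocycles, (z : A.carrier) ∈ A.deg n ∧ π z = x
  ker : ∀ z : A.cocycles, π z = 0 ↔ ∃ y, A.d y = z
  map_deg : ∀ (n : ℤ) (z : A.cocycles), (z : A.carrier) ∈ A.deg n → π z ∈ 𝓗 n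

theorem exists_homogeneous_preimage (A : DGA.{u, v} k) {n : ℤ} {x : A.carrier}
    (hx : x ∈ A.deg n) (h : ∃ y, A.d y = x) : ∃ y ∈ A.deg (n - 1), A.d y = x := by
  obtain ⟨y, rfl⟩ := h
  refine ⟨DirectSum.decompose A.deg y (n - 1), SetLike.coe_mem _, ?_⟩
  rw [d_decompose, sub_add_cancel, DirectSum.decompose_of_mem_same _ hx]

namespace HomologyModel

variable {A : DGA.{u, v} k} {H : Type v} [Ring H] [Algebra k H] {𝓗 : ℤ → Submodule k H}
  (M : HomologyModel A 𝓗)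

/-- `a` is a cocycle that represents `x`. -/
def Rep (a : A.carrier) (x : H) : Prop := ∃ h : A.d a = 0, M.π ⟨a, h⟩ = x

variable {M}

theorem Rep.d_eq_zero {a : A.carrier} {x : H} (h : M.Rep a x) : A.d a = 0 := h.1

theorem Rep.add {a b : A.carrier} {x y : H} (h : M.Rep a x) (h' : M.Rep b y) :
    M.Rep (a + b) (x + y) := by
  obtain ⟨ha, rfl⟩ := h
  obtain ⟨hb, rfl⟩ := h'
  exact ⟨by simp [ha, hb], map_add M.π ⟨a, ha⟩ ⟨b, hb⟩⟩

theorem Rep.sub {a b : A.carrier} {x y : H} (h : M.Rep a x) (h' : M.Rep b y) :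
    M.Rep (a - b) (x - y) := by
  obtain ⟨ha, rfl⟩ := h
  obtain ⟨hb, rfl⟩ := h'
  exact ⟨by simp [ha, hb], map_sub M.π ⟨a, ha⟩ ⟨b, hb⟩⟩

theorem Rep.neg {a : A.carrier} {x : H} (h : M.Rep a x) : M.Rep (-a) (-x) := by
  obtain ⟨ha, rfl⟩ := h
  exact ⟨by simp [ha], map_neg M.π ⟨a, ha⟩⟩

theorem Rep.zsmul {a : A.carrier} {x : H} (n : ℤ) (h : M.Rep a x) : M.Rep (n • a) (n • x) := by
  obtain ⟨ha, rfl⟩ := h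
  exact ⟨by rw [map_zsmul, ha, smul_zero], map_zsmul M.π n ⟨a, ha⟩⟩

theorem Rep.mul {a b : A.carrier} {x y : H} (h : M.Rep a x) (h' : M.Rep b y) :
    M.Rep (a * b) (x * y) := by
  obtain ⟨ha, rfl⟩ := h
  obtain ⟨hb, rfl⟩ := h'
  exact ⟨by rw [A.d_mul_of_d_eq_zero a hb, ha, zero_mul], map_mul M.π ⟨a, ha⟩ ⟨b, hb⟩⟩

variable (M) in
theorem rep_d (a : A.carrier) : M.Rep (A.d a) 0 := ⟨A.d_d a, (M.ker _).2 ⟨a, rfl⟩⟩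

variable (M) in
theorem rep_zero : M.Rep 0 0 := by simpa using M.rep_d 0

theorem Rep.exists_d {a : A.carrier} (h : M.Rep a 0) : ∃ b, A.d b = a := by
  obtain ⟨ha, h0⟩ := h
  exact (M.ker _).1 h0

theorem Rep.unique {a : A.carrier} {x y : H} (h : M.Rep a x) (h' : M.Rep a y) : x = y := by
  obtain ⟨ha, rfl⟩ := h
  exact h'.2

theorem Rep.mem {a : A.carrier} {x : H} {n : ℤ} (h : M.Rep a x) (ha : a ∈ A.deg n) : x ∈ 𝓗 n := by
  obtain ⟨h, rfl⟩ := h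
  exact M.map_deg n _ ha

end HomologyModel

/-! ### From a twisting cochain to a zigzag of quasi-isomorphisms. -/

section Zigzag

variable {A : DGA.{u, v} k} {H : Type v} [Ring H] [Algebra k H] {𝓗 : ℤ → Submodule k H}
  [GradedAlgebra 𝓗] (M : HomologyModel A 𝓗)

/-- A twisting cochain that represents the identification of the homology of `A` with `H`: the
components of `τ` are those of an `A_∞`-morphism from `H` to `A`. -/
structure IsTwisting (τ : List H → A.carrier) : Prop where
  multi : IsMulti k τ
  nil : τ [] = 0
  homog : IsHomog 𝓗 A.deg 1 τ
  rep : ∀ x, M.Rep (τ [x]) x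
  flat : curvature (signHom A.deg) A.d τ = 0

variable {M} {τ : List H → A.carrier} (hτ : IsTwisting M τ)
include hτ

theorem IsTwisting.twistD_singleton {φ : List H → A.carrier} (hφ : φ [] = 0) (x : H) :
    twistD (signHom A.deg) A.d τ φ [x] = -A.d (φ [x]) := by
  simp [twistD, barD_cons, cup_cons, parity, hφ, hτ.nil]

/-- By `twistD_insertOne`, a twisted cocycle is a boundary up to `ψ [1]` times `τ`; a primitive `z`
of `ψ [1]` turns this remainder into a boundary too. -/
theorem IsTwisting.eq_twistD {ψ : List H → A.carrier} (hψ : ψ [] = 0)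
    (hD : twistD (signHom A.deg) A.d τ ψ = 0) {z : A.carrier} (hz : A.d z = ψ [1]) :
    twistD (signHom A.deg) A.d τ
      (-(insertOne ψ + act (signHom A.deg) (signHom A.deg z) τ)) = ψ := by
  have hA := A.isTwistedDifferential
  rw [← zero_sub, Triangular.twistD_sub, twistD_add, twistD_insertOne τ hψ hD,
    Triangular.mulHead_one (by simp [act, hτ.nil]), hA.twistD_act, twistD_self hτ.flat, act_zero,
    hA.anticomm, hz, neg_act]
  have : twistD (signHom A.deg) A.d τ (0 : List H → A.carrier) = 0 := by
    simpa using twistD_smul (ε := signHom A.deg) (d := A.d) (0 : k) τ (0 : List H → A.carrier)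
  rw [this]
  abel

/-- The twisted dga of triangular matrices. -/
noncomputable def IsTwisting.dga : DGA.{u, v} k :=
  ofGraded (𝒯 := Triangular.degree A 𝓗) (D := Triangular.D hτ.multi hτ.nil)
    (Triangular.D_mem hτ.multi hτ.nil hτ.homog)
    (fun _ t _ => Triangular.D_D hτ.multi hτ.nil hτ.flat t)
    (fun n s hs _ t _ => Triangular.D_mul hτ.multi hτ.nil n s hs.1 t)

/-- The projection to the upper left entry. -/
noncomputable def IsTwisting.fst : Hom hτ.dga A :=
  ofGradedHom _ _ _ A (Triangular.fstHom A H) (fun _ _ h => h.1) fun _ _ _ => rfl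

/-- The projection to the lower right entry. -/
noncomputable def IsTwisting.snd : Hom hτ.dga (ofGradedAlgebra 𝓗) :=
  ofGradedHom _ _ _ (ofGradedAlgebra 𝓗) (Triangular.sndHom A H) (fun _ _ h => h.2.2)
    fun _ _ _ => rfl

/-- The cochain entry of the cocycle equation, evaluated at `[1]`, says that `τ [y] - a * τ [1]` is
exact for the diagonal entries `a` and `y`. Since `τ [1]` represents the unit, `a` represents `y`.
-/
theorem IsTwisting.rep_snd {t : Triangular A H}
    (hD : Triangular.D hτ.multi hτ.nil t = 0) : M.Rep t.1 t.2.2 := by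
  have hd : A.d t.1 = 0 := congrArg (fun s : Triangular A H => s.1) hD
  have h1 := congrFun (congrArg Triangular.cochain hD) [1]
  simp only [Triangular.cochain_D, Pi.add_apply, Pi.sub_apply, mulHead_cons, mul_one,
    hτ.twistD_singleton t.cochain_nil, Triangular.cochain_zero, Pi.zero_apply] at h1
  have h2 : act (signHom A.deg) (signHom A.deg t.1) τ [1] = t.1 * τ [1] := by
    simp [act, signHom_signHom]
  rw [h2] at h1
  have h3 : M.Rep t.1 (M.π ⟨t.1, hd⟩) := ⟨hd, rfl⟩
  have h4 := ((M.rep_d (t.cochain [1])).neg.add (hτ.rep t.2.2)).sub (h3.mul (hτ.rep 1))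
  rw [h1] at h4
  have h5 := h4.unique M.rep_zero
  have h6 : t.2.2 = M.π ⟨t.1, hd⟩ := by simpa [sub_eq_zero] using h5
  rw [h6]
  exact h3

theorem IsTwisting.exists_D {n : ℤ} {t : Triangular A H} (ht : t ∈ Triangular.degree A 𝓗 n)
    (hD : Triangular.D hτ.multi hτ.nil t = 0) (hex : ∃ b, A.d b = t.1) :
    ∃ s ∈ Triangular.degree A 𝓗 (n - 1), Triangular.D hτ.multi hτ.nil s = t := by
  have hA := A.isTwistedDifferential
  obtain ⟨b, hb, hbt⟩ := A.exists_homogeneous_preimage ht.1 hex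
  have hy : t.2.2 = 0 := (hτ.rep_snd hD).unique (hbt ▸ M.rep_d b)
  have h1 := congrArg Triangular.cochain hD
  rw [Triangular.cochain_D, hy, Triangular.mulHead_zero_right hτ.multi, add_zero,
    Triangular.cochain_zero] at h1
  -- The cochain entry of `t - D (b, 0, 0)`, whose diagonal entries are both zero; so `ψ` is a
  -- twisted cocycle.
  set ψ : List H → A.carrier := t.cochain + act (signHom A.deg) (signHom A.deg b) τ with hψ
  have hψm : IsMulti k ψ := t.cochain_multi.add (hτ.multi.act _ _)
  have hψ0 : ψ [] = 0 := by simp [hψ, act, hτ.nil]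
  have hbh : IsHomog 𝓗 A.deg n (act (signHom A.deg) (signHom A.deg b) τ) := by
    have := IsHomog.act (𝒜 := A.deg) (fun _ _ => signHom_mem A.deg) (signHom_mem A.deg hb)
      hτ.homog
    rwa [sub_add_cancel] at this
  have hψh : IsHomog 𝓗 A.deg n ψ := ht.2.1.add hbh
  have hψD : twistD (signHom A.deg) A.d τ ψ = 0 := by
    rw [hψ, twistD_add, hA.twistD_act, twistD_self hτ.flat, act_zero, hA.anticomm, hbt, neg_act]
    rw [add_zero, ← sub_eq_add_neg]
    exact h1
  have hd : A.d (ψ [1]) = 0 := by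
    have := congrFun hψD [1]
    rw [hτ.twistD_singleton hψ0] at this
    simpa using this
  have hmem : ψ [1] ∈ A.deg (n - 1) :=
    mem_of_deg_eq (hψh [1] [0] (.cons (SetLike.one_mem_graded 𝓗) .nil)) (by simp; ring)
  -- The contraction leaves `ψ [1]` times `τ`. Since `ψ [1]` is a cocycle, subtracting it from `b`
  -- absorbs this term without changing the upper left entry of the boundary.
  refine ⟨(b - ψ [1], ⟨-insertOne ψ, hψm.insertOne.neg, by simp⟩, 0),
    ⟨sub_mem hb hmem, hψh.insertOne.neg, zero_mem _⟩, ?_⟩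
  ext1
  · change A.d (b - ψ [1]) = t.1
    rw [map_sub, hd, sub_zero, hbt]
  · change twistD (signHom A.deg) A.d τ (-insertOne ψ) + mulHead τ 0 -
      act (signHom A.deg) (signHom A.deg (b - ψ [1])) τ = t.cochain
    have h0 : twistD (signHom A.deg) A.d τ (0 : List H → A.carrier) = 0 := by
      simpa using twistD_smul (ε := signHom A.deg) (d := A.d) (0 : k) τ (0 : List H → A.carrier)
    rw [Triangular.mulHead_zero_right hτ.multi, ← zero_sub (insertOne ψ), Triangular.twistD_sub,
      twistD_insertOne τ hψ0 hψD, Triangular.mulHead_one (by simp [act, hτ.nil]), h0, map_sub,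
      sub_eq_add_neg (signHom A.deg b), add_act, neg_act, hψ]
    abel
  · exact hy.symm

/-- The cochain entry must have the prescribed twisted differential `ψ` below. This `ψ` is a twisted
cocycle, and `ψ [1] = a * τ [1] - τ [y]` is exact because `a` represents `y`; `eq_twistD` then
solves the equation. -/
theorem IsTwisting.exists_cocycle {n : ℤ} {a : A.carrier} {y : H} (ha : a ∈ A.deg n)
    (hay : M.Rep a y) : ∃ t ∈ Triangular.degree A 𝓗 n,
      Triangular.D hτ.multi hτ.nil t = 0 ∧ t.1 = a ∧ t.2.2 = y := by
  have hA := A.isTwistedDifferential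
  set ψ : List H → A.carrier := act (signHom A.deg) (signHom A.deg a) τ - mulHead τ y with hψ
  have hψm : IsMulti k ψ := (hτ.multi.act _ _).sub (hτ.multi.mulHead _)
  have hψ0 : ψ [] = 0 := by simp [hψ, act, hτ.nil]
  have hy := hay.mem ha
  have hψh : IsHomog 𝓗 A.deg (n + 1) ψ := by
    refine (IsHomog.act (𝒜 := A.deg) (fun _ _ => signHom_mem A.deg) (signHom_mem A.deg ha)
      hτ.homog).sub ?_
    rw [add_comm]
    exact hτ.homog.mulHead hy
  have hψD : twistD (signHom A.deg) A.d τ ψ = 0 := by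
    rw [hψ, Triangular.twistD_sub, hA.twistD_act, twistD_mulHead τ hτ.nil, twistD_self hτ.flat,
      act_zero, hA.anticomm, hay.d_eq_zero, Triangular.mulHead_zero_left]
    simp [zero_act]
  have h1 : M.Rep (ψ [1]) 0 := by
    have e : ψ [1] = a * τ [1] - τ [y] := by simp [hψ, act, signHom_signHom]
    have := (hay.mul (hτ.rep 1)).sub (hτ.rep y)
    rwa [mul_one, sub_self, ← e] at this
  have hmem : ψ [1] ∈ A.deg n :=
    mem_of_deg_eq (hψh [1] [0] (.cons (SetLike.one_mem_graded 𝓗) .nil)) (by simp)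
  obtain ⟨z, hz, hzψ⟩ := A.exists_homogeneous_preimage hmem h1.exists_d
  have hzh : IsHomog 𝓗 A.deg n (act (signHom A.deg) (signHom A.deg z) τ) := by
    have := IsHomog.act (𝒜 := A.deg) (fun _ _ => signHom_mem A.deg) (signHom_mem A.deg hz)
      hτ.homog
    rwa [sub_add_cancel] at this
  have hih : IsHomog 𝓗 A.deg n (insertOne ψ) := by
    have := hψh.insertOne
    rwa [add_sub_cancel_right] at this
  refine ⟨(a, ⟨-(insertOne ψ + act (signHom A.deg) (signHom A.deg z) τ),
    (hψm.insertOne.add (hτ.multi.act _ _)).neg, by simp [act, hτ.nil]⟩, y),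
    ⟨ha, (hih.add hzh).neg, hy⟩, ?_, rfl, rfl⟩
  ext1
  · exact hay.d_eq_zero
  · change twistD (signHom A.deg) A.d τ (-(insertOne ψ + act (signHom A.deg) (signHom A.deg z) τ))
      + mulHead τ y - act (signHom A.deg) (signHom A.deg a) τ = 0
    rw [hτ.eq_twistD hψ0 hψD hzψ, hψ]
    abel
  · rfl

theorem IsTwisting.of_eq_of_D_eq {n : ℤ} (t : Triangular.degree A 𝓗 n)
    (h : ∃ s ∈ Triangular.degree A 𝓗 (n - 1), Triangular.D hτ.multi hτ.nil s = t) :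
    ∃ y, hτ.dga.d y = DirectSum.of (fun n => Triangular.degree A 𝓗 n) n t := by
  obtain ⟨s, hs, hst⟩ := h
  refine ⟨DirectSum.of (fun n => Triangular.degree A 𝓗 n) (n - 1) ⟨s, hs⟩, ?_⟩
  refine (sumD_of (Triangular.D_mem hτ.multi hτ.nil hτ.homog) ⟨s, hs⟩).trans ?_
  have := of_congr (Triangular.degree A 𝓗) (sub_add_cancel n 1).symm (hst ▸ t.2)
    (Triangular.D_mem hτ.multi hτ.nil hτ.homog (n - 1) s hs)
  rw [← this]
  congr 1
  exact Subtype.ext hst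

theorem IsTwisting.D_eq_zero {n : ℤ} (t : Triangular.degree A 𝓗 n)
    (h : hτ.dga.d (DirectSum.of (fun n => Triangular.degree A 𝓗 n) n t) = 0) :
    Triangular.D hτ.multi hτ.nil t = 0 := by
  have h1 := (sumD_of (Triangular.D_mem hτ.multi hτ.nil hτ.homog) t).symm.trans h
  have h2 := DirectSum.of_injective (β := fun n => Triangular.degree A 𝓗 n) (n + 1)
    (h1.trans (map_zero _).symm)
  exact congrArg Subtype.val h2

theorem IsTwisting.d_of_eq_zero {n : ℤ} (t : Triangular.degree A 𝓗 n)
    (h : Triangular.D hτ.multi hτ.nil t = 0) :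
    hτ.dga.d (DirectSum.of (fun n => Triangular.degree A 𝓗 n) n t) = 0 := by
  refine (sumD_of (Triangular.D_mem hτ.multi hτ.nil hτ.homog) t).trans ?_
  simp only [h]
  exact map_zero (DirectSum.of (fun n => Triangular.degree A 𝓗 n) (n + 1))

theorem IsTwisting.fst_of {n : ℤ} (t : Triangular.degree A 𝓗 n) :
    hτ.fst.toAlgHom (DirectSum.of (fun n => Triangular.degree A 𝓗 n) n t) = t.1.1 :=
  congrArg (Triangular.fstHom A H) (DirectSum.coeAlgHom_of (Triangular.degree A 𝓗) n t)

theorem IsTwisting.snd_of {n : ℤ} (t : Triangular.degree A 𝓗 n) :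
    hτ.snd.toAlgHom (DirectSum.of (fun n => Triangular.degree A 𝓗 n) n t) = t.1.2.2 :=
  congrArg (Triangular.sndHom A H) (DirectSum.coeAlgHom_of (Triangular.degree A 𝓗) n t)

theorem IsTwisting.fst_isQuasiIso : hτ.fst.IsQuasiIso := by
  refine isQuasiIso_of_homogeneous _ ?_ ?_
  · rintro n _ ⟨t, rfl⟩ ht hb
    refine hτ.of_eq_of_D_eq t (hτ.exists_D t.2 (hτ.D_eq_zero t ht) ?_)
    obtain ⟨b, hb⟩ := hb
    exact ⟨b, hb.trans (hτ.fst_of t)⟩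
  · intro n a ha hd
    obtain ⟨t, ht, hD, hta, -⟩ := hτ.exists_cocycle ha (y := M.π ⟨a, hd⟩) ⟨hd, rfl⟩
    refine ⟨_, hτ.d_of_eq_zero ⟨t, ht⟩ hD, 0, ?_⟩
    rw [hτ.fst_of, map_zero, hta, sub_self]

theorem IsTwisting.snd_isQuasiIso : hτ.snd.IsQuasiIso := by
  refine isQuasiIso_of_homogeneous _ ?_ ?_
  · rintro n _ ⟨t, rfl⟩ ht ⟨b, hb⟩
    refine hτ.of_eq_of_D_eq t (hτ.exists_D t.2 (hτ.D_eq_zero t ht) ?_)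
    -- The target has zero differential, so the lower right entry is zero; the upper left entry
    -- represents it and is therefore exact.
    have h1 := hτ.rep_snd (hτ.D_eq_zero t ht)
    have h2 : t.1.2.2 = 0 := (hτ.snd_of t).symm.trans hb.symm
    rw [h2] at h1
    exact h1.exists_d
  · intro n (y : H) hy hd
    have hy' : y ∈ 𝓗 n := hy
    have hmem : τ [y] ∈ A.deg n :=
      mem_of_deg_eq (hτ.homog [y] [n] (.cons hy' .nil)) (by simp)
    obtain ⟨t, ht, hD, -, hty⟩ := hτ.exists_cocycle hmem (hτ.rep y)
    refine ⟨_, hτ.d_of_eq_zero ⟨t, ht⟩ hD, 0, ?_⟩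
    rw [hτ.snd_of, map_zero]
    exact (sub_eq_zero.2 hty).symm

theorem IsTwisting.quasiIsomorphic : QuasiIsomorphic A (ofGradedAlgebra 𝓗) :=
  (Relation.EqvGen.symm _ _ (.rel _ _ ⟨hτ.fst, hτ.fst_isQuasiIso⟩)).trans _ _ _
    (.rel _ _ ⟨hτ.snd, hτ.snd_isQuasiIso⟩)

end Zigzag

end DGA

namespace ListCochain

/-! ### Lowest-arity terms of cup products and curvature. -/

section Support

variable {k : Type*} [CommRing k] {H : Type*} [Ring H] {A : Type*} [Ring A] [Algebra k A]
  (ε : A →ₐ[k] A) {d : A →ₗ[k] A}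

theorem cup_eq_zero {p q : ℕ} {φ ψ : List H → A} (hφ : ∀ l, l.length < p → φ l = 0)
    (hψ : ∀ l, l.length < q → ψ l = 0) {l : List H} (hl : l.length < p + q) :
    cup ε φ ψ l = 0 := by
  induction l generalizing φ p with
  | nil =>
    rcases Nat.eq_zero_or_pos p with rfl | hp
    · rw [cup_nil, hψ [] (by simpa using hl), mul_zero]
    · rw [cup_nil, hφ [] hp, zero_mul]
  | cons x l ih =>
    rw [List.length_cons] at hl
    rw [cup_cons, ih (p := p - 1) (φ := shift x φ)
      (fun l' hl' => hφ (x :: l') (by rw [List.length_cons]; omega)) (by omega), add_zero]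
    rcases Nat.eq_zero_or_pos p with rfl | hp
    · rw [hψ _ (by rw [List.length_cons]; omega), mul_zero]
    · rw [hφ [] hp, map_zero, zero_mul]

/-- In the lowest possible arity only one splitting of the list contributes. -/
theorem cup_append {φ ψ : List H → A} {l₁ l₂ : List H}
    (hφ : ∀ l, l.length < l₁.length → φ l = 0) (hψ : ∀ l, l.length < l₂.length → ψ l = 0) :
    cup ε φ ψ (l₁ ++ l₂) = (ε ^ l₂.length) (φ l₁) * ψ l₂ := by
  induction l₁ generalizing φ with
  | nil =>
    cases l₂ with
    | nil => simp
    | cons x l =>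
      rw [List.nil_append, cup_cons, cup_eq_zero ε (p := 0) (by simp) hψ (by simp), add_zero]
      rfl
  | cons x l ih =>
    rw [List.cons_append, cup_cons, hφ [] (by simp), map_zero, zero_mul, zero_add,
      ih (φ := shift x φ) fun l' hl' => hφ (x :: l') (by simpa using hl')]
    rfl

theorem curvature_add (τ w : List H → A) :
    curvature ε d (τ + w) = curvature ε d τ +
      (barD d w - cup ε (parity ε τ) w - cup ε (parity ε w) τ - cup ε (parity ε w) w) := by
  simp only [curvature, barD_add, parity_add, cup_add_left, cup_add_right]
  abel

theorem parity_eq_zero {φ : List H → A} {l : List H} (h : φ l = 0) : parity ε φ l = 0 := by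
  simp [parity, h]

theorem curvature_add_of_lt {p : ℕ} (τ : List H → A) {w : List H → A}
    (hw : ∀ l, l.length < p → w l = 0) {l : List H} (hl : l.length < p) :
    curvature ε d (τ + w) l = curvature ε d τ l := by
  rw [curvature_add]
  simp only [Pi.add_apply, Pi.sub_apply]
  rw [barD_apply, hw l hl, barD_zero_eq_zero fun l' hl' => hw l' (by omega),
    cup_eq_zero ε (p := 0) (by simp) hw (by omega),
    cup_eq_zero ε (p := p) (q := 0) (fun l h => parity_eq_zero ε (hw l h)) (by simp) (by omega),
    cup_eq_zero ε (p := p) (fun l h => parity_eq_zero ε (hw l h)) hw (by omega)]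
  simp

theorem curvature_congr {τ τ' : List H → A} {l : List H}
    (h : ∀ l' : List H, l'.length ≤ l.length → τ l' = τ' l') :
    curvature ε d τ l = curvature ε d τ' l := by
  rw [← sub_add_cancel τ τ', add_comm]
  exact curvature_add_of_lt ε (p := l.length + 1) τ'
    (fun l' hl' => sub_eq_zero.2 (h l' (Nat.lt_succ_iff.1 hl'))) (Nat.lt_succ_self _)

theorem length_lt_one {φ : List H → A} (h : φ [] = 0) (l : List H) (hl : l.length < 1) :
    φ l = 0 := by
  rw [List.length_eq_zero_iff.1 (Nat.lt_one_iff.1 hl), h]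

/-- Since `τ` starts in arity 1 and `w` in arity `p > 0`, all cup products with `w` start above
arity `p`; only the internal differential is seen. -/
theorem curvature_add_of_eq {p : ℕ} (hp : 0 < p) {τ w : List H → A} (hτ : τ [] = 0)
    (hw : ∀ l, l.length < p → w l = 0) {l : List H} (hl : l.length = p) :
    curvature ε d (τ + w) l = curvature ε d τ l + (-1 : ℤ) ^ p • d (w l) := by
  rw [curvature_add]
  simp only [Pi.add_apply, Pi.sub_apply]
  rw [barD_apply, barD_zero_eq_zero fun l' hl' => hw l' (by omega),
    cup_eq_zero ε (p := 1) (length_lt_one (parity_eq_zero ε hτ)) hw (by omega),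
    cup_eq_zero ε (p := p) (q := 1) (fun l h => parity_eq_zero ε (hw l h)) (length_lt_one hτ)
      (by omega),
    cup_eq_zero ε (p := p) (fun l h => parity_eq_zero ε (hw l h)) hw (by omega), hl]
  simp

/-- The change of the curvature in arity `p + 1` under a change of `τ` in arity `p`. -/
theorem curvature_add_of_eq_succ (hε : ∀ a, ε (ε a) = a) {p : ℕ} (hp : 2 ≤ p)
    {τ w : List H → A} (hτ : τ [] = 0)
    (hw : ∀ l, l.length ≠ p → w l = 0) {x y : H} {l₁ l₂ : List H} (h₁ : l₁.length = p)
    (h₂ : l₂.length = p) (h : x :: l₁ = l₂ ++ [y]) :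
    curvature ε d (τ + w) (x :: l₁) = curvature ε d τ (x :: l₁) +
      (barD (0 : A →ₗ[k] A) w (x :: l₁) + (ε ^ (p + 1)) (τ [x]) * w l₁
        + (-1 : ℤ) ^ (p + 1) • (w l₂ * τ [y])) := by
  have hw' : ∀ l : List H, l.length < p → w l = 0 := fun l hl => hw l hl.ne
  -- The two mixed products are in their lowest arity, so each has one term. The term quadratic in
  -- `w` starts in arity `2 * p > p + 1`, which is where `2 ≤ p` is needed.
  have e1 : cup ε (parity ε τ) w (x :: l₁) = -((ε ^ (p + 1)) (τ [x]) * w l₁) := by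
    have := cup_append ε (φ := parity ε τ) (ψ := w) (l₁ := [x]) (l₂ := l₁)
      (length_lt_one (parity_eq_zero ε hτ)) (h₁ ▸ hw')
    rw [List.singleton_append] at this
    rw [this, h₁, pow_succ_apply]
    simp [parity]
  have e2 : cup ε (parity ε w) τ (x :: l₁) = (-1 : ℤ) ^ p • (w l₂ * τ [y]) := by
    rw [h, cup_append ε (l₂ := [y])
      (fun l hl => parity_eq_zero ε (hw' l (h₂ ▸ hl))) (length_lt_one hτ)]
    simp [parity, h₂, hε, -zsmul_eq_mul]
  rw [curvature_add]
  simp only [Pi.add_apply, Pi.sub_apply]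
  rw [barD_apply, hw (x :: l₁) (by simp [h₁]), e1, e2,
    cup_eq_zero ε (p := p) (fun l h => parity_eq_zero ε (hw' l h)) hw'
      (by rw [List.length_cons]; omega), pow_succ (-1 : ℤ), mul_neg_one, neg_smul, map_zero,
    smul_zero]
  abel

end Support

/-! ### Cochains on lists versus multilinear maps. -/

section Fin

variable {k : Type*} [CommRing k] {H : Type*} [Ring H] [Algebra k H]
  {W : Type*} [AddCommGroup W] [Module k W]

theorem barD_zero_ofFn {n : ℕ} (φ : List H → W) (x : Fin (n + 1) → H) :
    barD (0 : W →ₗ[k] W) φ (List.ofFn x) =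
      ∑ i : Fin n, (-1 : ℤ) ^ ((i : ℕ) + 1) •
        φ (List.ofFn (Fin.contractNth i.castSucc (· * ·) x)) := by
  induction n generalizing φ with
  | zero => simp [List.ofFn_succ, barD_cons]
  | succ n ih =>
    have h := ih (shift (x 0) φ) (Fin.tail x)
    rw [List.ofFn_succ, barD_cons]
    change -mulHead φ (x 0) (List.ofFn (Fin.tail x)) -
      barD 0 (shift (x 0) φ) (List.ofFn (Fin.tail x)) = _
    rw [h, Fin.sum_univ_succ, sub_eq_add_neg, ← Finset.sum_neg_distrib]
    congr 1
    · rw [List.ofFn_succ, mulHead_cons, List.ofFn_succ]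
      simp [Fin.contractNth, Fin.tail]
    · refine Finset.sum_congr rfl fun i _ => ?_
      have e : List.ofFn (Fin.contractNth i.succ.castSucc (· * ·) x) =
          x 0 :: List.ofFn (Fin.contractNth i.castSucc (· * ·) (Fin.tail x)) := by
        rw [List.ofFn_succ]
        congr 2
        funext j
        simp [Fin.contractNth, Fin.tail]
      rw [e, Fin.val_succ, pow_succ _ ((i : ℕ) + 1), mul_neg_one, neg_smul]
      rfl

theorem exists_ofFn_update {n : ℕ} (x : Fin n → H) (j : Fin n) :
    ∃ l₁ l₂ : List H, ∀ y, List.ofFn (Function.update x j y) = l₁ ++ y :: l₂ := by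
  induction n with
  | zero => exact j.elim0
  | succ n ih =>
    refine Fin.cases ?_ (fun j => ?_) j
    · refine ⟨[], List.ofFn (Fin.tail x), fun y => ?_⟩
      rw [List.ofFn_succ]
      simp
      rfl
    · obtain ⟨l₁, l₂, h⟩ := ih (Fin.tail x) j
      refine ⟨x 0 :: l₁, l₂, fun y => ?_⟩
      rw [List.ofFn_succ, List.cons_append, ← h y]
      congr 1
      refine congrArg List.ofFn (funext fun i => ?_)
      simp [Fin.tail, Function.update_apply]

/-- The component in arity `n` of a multilinear cochain. -/
def toMultilinear (n : ℕ) {φ : List H → W} (hφ : IsMulti k φ) :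
    MultilinearMap k (fun _ : Fin n => H) W where
  toFun x := φ (List.ofFn x)
  map_update_add' := by
    intro inst x j y z
    have e : inst = instDecidableEqFin n := Subsingleton.elim _ _
    subst e
    obtain ⟨l₁, l₂, h⟩ := exists_ofFn_update x j
    simpa [h] using hφ l₁ l₂ 1 y z
  map_update_smul' := by
    intro inst x j c y
    have e : inst = instDecidableEqFin n := Subsingleton.elim _ _
    subst e
    obtain ⟨l₁, l₂, h⟩ := exists_ofFn_update x j
    have h0 : φ (l₁ ++ 0 :: l₂) = 0 := by simpa using hφ l₁ l₂ 1 0 0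
    simpa [h, h0] using hφ l₁ l₂ c 0 y

/-- A multilinear map in `n` variables, as a cochain concentrated in arity `n`. -/
def ofMultilinear {n : ℕ} (g : MultilinearMap k (fun _ : Fin n => H) W) : List H → W :=
  fun l => if h : l.length = n then g (fun i => l[i]'(h ▸ i.2)) else 0

theorem ofMultilinear_ofFn {n : ℕ} (g : MultilinearMap k (fun _ : Fin n => H) W)
    (x : Fin n → H) : ofMultilinear g (List.ofFn x) = g x := by
  simp [ofMultilinear]

theorem ofMultilinear_of_ne {n : ℕ} (g : MultilinearMap k (fun _ : Fin n => H) W) {l : List H}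
    (h : l.length ≠ n) : ofMultilinear g l = 0 := dif_neg h

theorem isMulti_ofMultilinear {n : ℕ} (g : MultilinearMap k (fun _ : Fin n => H) W) :
    IsMulti k (ofMultilinear g) := by
  intro l₁ l₂ c x y
  by_cases h : l₁.length + (l₂.length + 1) = n
  · have key : ∀ z, ofMultilinear g (l₁ ++ z :: l₂) =
        g (Function.update (fun i : Fin n => (l₁ ++ 0 :: l₂)[i]'(by simp; omega))
          ⟨l₁.length, by omega⟩ z) := by
      intro z
      rw [ofMultilinear, dif_pos (by simpa using h)]
      congr 1
      funext i
      simp only [Function.update_apply, Fin.ext_iff, Fin.getElem_fin, List.getElem_append,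
        List.getElem_cons]
      split_ifs <;> first | rfl | omega
    simp [key]
  · have key : ∀ z, ofMultilinear g (l₁ ++ z :: l₂) = 0 := fun z =>
      ofMultilinear_of_ne g (by simpa using h)
    simp [key]

theorem exists_eq_ofFn {n : ℕ} {l : List H} (h : l.length = n) : ∃ x : Fin n → H,
    l = List.ofFn x := by
  subst h
  exact ⟨fun i => l[i], by simp⟩

end Fin

/-! ### Comparison with the Hochschild complex. -/

section Hochschild

variable {k : Type*} [CommRing k] {H : Type*} [Ring H] [Algebra k H] {𝓗 : ℤ → Submodule k H}

theorem toMultilinear_mem {n : ℕ} {m j : ℤ} {φ : List H → H} (hφ : IsMulti k φ)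
    (hφ' : IsHomog 𝓗 𝓗 j φ) (hm : m = j - n) : toMultilinear n hφ ∈ hochschildCochains 𝓗 n m := by
  intro p x hx
  have h : List.Forall₂ (fun x n => x ∈ 𝓗 n) (List.ofFn x) (List.ofFn p) := by
    rw [List.forall₂_iff_get]
    exact ⟨by simp, fun i hi _ => by simpa using hx ⟨i, by simpa using hi⟩⟩
  refine mem_of_deg_eq (hφ' _ _ h) ?_
  rw [List.sum_ofFn, List.length_ofFn, hm]
  ring

theorem isHomog_ofMultilinear {n : ℕ} {m j : ℤ} {g : MultilinearMap k (fun _ : Fin n => H) H}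
    (hg : g ∈ hochschildCochains 𝓗 n m) (hm : m = j - n) : IsHomog 𝓗 𝓗 j (ofMultilinear g) := by
  intro l p h
  by_cases hl : l.length = n
  · have hp : p.length = n := h.length_eq.symm.trans hl
    have hl' := hl
    obtain ⟨x, rfl⟩ := exists_eq_ofFn hl
    obtain ⟨q, rfl⟩ : ∃ q : Fin n → ℤ, p = List.ofFn q := by
      subst hp
      exact ⟨fun i => p[i], by simp⟩
    rw [ofMultilinear_ofFn]
    refine mem_of_deg_eq (hg q x fun i => ?_) ?_
    · rw [List.forall₂_iff_get] at h
      simpa using h.2 i (by simp) (by simp)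
    · rw [List.sum_ofFn, hl', hm]
      ring
  · rw [ofMultilinear_of_ne g hl]
    exact zero_mem _

theorem hochschildDelta_eq_barD [GradedAlgebra 𝓗] {n : ℕ} (m : ℤ)
    (g : MultilinearMap k (fun _ : Fin n => H) H) {φ : List H → H}
    (hφ : ∀ x, g x = φ (List.ofFn x)) (x : Fin (n + 1) → H) :
    hochschildDelta 𝓗 n m g x = (m.negOnePow : ℤ) •
      (koszulSign 𝓗 m (x 0) * φ (List.ofFn (Fin.tail x)) +
        barD (0 : H →ₗ[k] H) φ (List.ofFn x) +
        (-1 : ℤ) ^ (n + 1) • (φ (List.ofFn (Fin.init x)) * x (Fin.last n))) := by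
  rw [hochschildDelta_apply, barD_zero_ofFn]
  simp only [hφ]

end Hochschild

end ListCochain

namespace DGA

open ListCochain

/-! ### Homogeneous linear sections and contractions over a field. -/

section Graded

variable {k : Type*} [CommRing k] {V : Type*} [AddCommGroup V] [Module k V]
  {W : Type*} [AddCommGroup W] [Module k W] (𝒱 : ℤ → Submodule k V) [DirectSum.Decomposition 𝒱]

/-- The linear map with prescribed restrictions to the homogeneous parts. -/
def glue (f : ∀ n, 𝒱 n →ₗ[k] W) : V →ₗ[k] W :=
  DirectSum.toModule k ℤ W f ∘ₗ (DirectSum.decomposeLinearEquiv 𝒱).toLinearMap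

theorem glue_coe (f : ∀ n, 𝒱 n →ₗ[k] W) {n : ℤ} (x : 𝒱 n) : glue 𝒱 f x = f n x := by
  rw [glue, LinearMap.comp_apply, LinearEquiv.coe_coe, DirectSum.decomposeLinearEquiv_apply,
    DirectSum.decompose_coe, ← DirectSum.lof_eq_of k, DirectSum.toModule_lof]

end Graded

theorem exists_section {k : Type u} [Field k] {A : DGA.{u, v} k} {H : Type v} [Ring H]
    [Algebra k H] {𝓗 : ℤ → Submodule k H} [GradedAlgebra 𝓗] (M : HomologyModel A 𝓗) :
    ∃ s : H →ₗ[k] A.carrier, (∀ n, ∀ x ∈ 𝓗 n, s x ∈ A.deg n) ∧ ∀ x, M.Rep (s x) x := by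
  have key : ∀ n, ∃ g : 𝓗 n →ₗ[k] A.carrier, ∀ x, g x ∈ A.deg n ∧ M.Rep (g x) x := by
    intro n
    let Z : Submodule k A.cocycles := (A.deg n).comap A.cocycles.val.toLinearMap
    let p : Z →ₗ[k] 𝓗 n := M.π.toLinearMap.restrict fun z hz => M.map_deg n z hz
    have hp : Function.Surjective p := by
      rintro ⟨x, hx⟩
      obtain ⟨z, hz, rfl⟩ := M.exists_cocycle n x hx
      exact ⟨⟨z, hz⟩, rfl⟩
    obtain ⟨g, hg⟩ := p.exists_rightInverse_of_surjective (LinearMap.range_eq_top.2 hp)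
    refine ⟨A.cocycles.val.toLinearMap ∘ₗ Z.subtype ∘ₗ g, fun x => ⟨(g x).2, ?_⟩⟩
    exact ⟨(g x).1.2, congrArg Subtype.val (LinearMap.congr_fun hg x)⟩
  choose g hg using key
  refine ⟨glue 𝓗 g, fun n x hx => ?_, fun x => ?_⟩
  · rw [glue_coe 𝓗 g ⟨x, hx⟩]
    exact (hg n _).1
  · induction x using DirectSum.Decomposition.inductionOn 𝓗 with
    | zero => simpa using M.rep_zero
    | homogeneous x => rw [glue_coe]; exact (hg _ x).2
    | add x y hx hy => rw [map_add]; exact hx.add hy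

/-- Over a field the differential splits onto its image in each degree. A linear choice of
primitives keeps corrections to `τ` multilinear; the degree is written `n + -1` to fit
`IsHomog.comp`. -/
theorem exists_contraction {k : Type u} [Field k] (A : DGA.{u, v} k) :
    ∃ r : A.carrier →ₗ[k] A.carrier, (∀ n, ∀ x ∈ A.deg n, r x ∈ A.deg (n + -1)) ∧
      ∀ x, A.d (r (A.d x)) = A.d x := by
  have key : ∀ n : ℤ, ∃ g : A.carrier →ₗ[k] A.carrier, ∀ x, g x ∈ A.deg (n + -1) ∧
      (x ∈ A.deg (n + -1) → A.d (g (A.d x)) = A.d x) := by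
    intro n
    let f : A.deg (n + -1) →ₗ[k] A.carrier := A.d ∘ₗ (A.deg (n + -1)).subtype
    obtain ⟨s, hs⟩ := f.rangeRestrict.exists_rightInverse_of_surjective
      (LinearMap.range_rangeRestrict f)
    obtain ⟨g, hg⟩ := s.exists_extend
    refine ⟨(A.deg (n + -1)).subtype ∘ₗ g, fun x => ⟨(g x).2, fun hx => ?_⟩⟩
    have h1 : g (A.d x) = s (f.rangeRestrict ⟨x, hx⟩) :=
      LinearMap.congr_fun hg (f.rangeRestrict ⟨x, hx⟩)
    have h2 := congrArg Subtype.val (LinearMap.congr_fun hs (f.rangeRestrict ⟨x, hx⟩))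
    change A.d (g (A.d x) : A.deg (n + -1)) = A.d x
    rw [h1]
    exact h2
  choose g hg using key
  refine ⟨glue A.deg fun n => g n ∘ₗ (A.deg n).subtype, fun n x hx => ?_, fun x => ?_⟩
  · rw [glue_coe A.deg _ ⟨x, hx⟩]
    exact (hg n _).1
  · induction x using DirectSum.Decomposition.inductionOn A.deg with
    | zero => simp
    | @homogeneous n x =>
      rw [glue_coe A.deg _ ⟨A.d x, A.d_mem x.2⟩]
      exact (hg (n + 1) x).2 (by simp)
    | add x y hx hy => simp only [map_add, hx, hy]

/-! ### Obstruction theory for twisting cochains. -/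

section Obstruction

variable {k : Type u} {H : Type v} [Ring H]

theorem exists_hochschildDelta_eq [CommRing k] [Algebra k H] {𝓗 : ℤ → Submodule k H}
    [GradedAlgebra 𝓗] {n : ℕ} {m : ℤ}
    (h : Subsingleton (HH 𝓗 (n + 1) m)) {f : MultilinearMap k (fun _ : Fin (n + 1) => H) H}
    (hf : f ∈ hochschildCochains 𝓗 (n + 1) m) (hδ : hochschildDelta 𝓗 (n + 1) m f = 0) :
    ∃ g ∈ hochschildCochains 𝓗 n m, hochschildDelta 𝓗 n m g = f := by
  have hker : (⟨f, hf⟩ : HochschildCochain 𝓗 (n + 1) m) ∈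
      LinearMap.ker (hochschildD 𝓗 (n + 1) m) := Subtype.ext hδ
  have h2 : (⟨⟨f, hf⟩, hker⟩ : LinearMap.ker (hochschildD 𝓗 (n + 1) m)) ∈
      (hochschildBoundaries 𝓗 (n + 1) m).submoduleOf (LinearMap.ker (hochschildD 𝓗 (n + 1) m)) :=
    (Submodule.Quotient.mk_eq_zero _).1 (Subsingleton.elim _ _)
  obtain ⟨g, hg⟩ := h2
  exact ⟨g.1, g.2, congrArg Subtype.val hg⟩

namespace HomologyModel

variable [Field k] [Algebra k H] {A : DGA.{u, v} k} {𝓗 : ℤ → Submodule k H} [GradedAlgebra 𝓗]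
  {M : HomologyModel A 𝓗}

theorem Rep.smul {a : A.carrier} {x : H} (c : k) (h : M.Rep a x) : M.Rep (c • a) (c • x) := by
  obtain ⟨ha, rfl⟩ := h
  exact ⟨by simp [ha], map_smul M.π c ⟨a, ha⟩⟩

theorem Rep.barD {φ : List H → A.carrier} {γ : List H → H} {l : List H}
    (h : ∀ l' : List H, l'.length + 1 = l.length → M.Rep (φ l') (γ l')) :
    M.Rep (barD (0 : A.carrier →ₗ[k] A.carrier) φ l) (barD (0 : H →ₗ[k] H) γ l) := by
  induction l generalizing φ γ with
  | nil => simpa using M.rep_zero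
  | cons x l ih =>
    rw [barD_cons, barD_cons]
    refine Rep.sub (Rep.neg ?_) (ih fun l' hl' => h (x :: l') (by simpa using hl'))
    cases l with
    | nil => simpa using M.rep_zero
    | cons y l => exact h _ (by simp)

theorem rep_signHom_pow {τ : List H → A.carrier} (hm : IsMulti k τ) (hh : IsHomog 𝓗 A.deg 1 τ)
    (hr : ∀ x, M.Rep (τ [x]) x) (m : ℕ) (x : H) :
    M.Rep ((signHom A.deg ^ m) (τ [x])) (koszulSign 𝓗 m x) := by
  have hadd : ∀ x y, τ [x + y] = τ [x] + τ [y] := fun x y => by simpa using hm [] [] 1 x y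
  rw [signHom_pow_apply]
  induction x using DirectSum.Decomposition.inductionOn 𝓗 with
  | zero =>
    have : τ [0] = 0 := by simpa using hadd 0 0
    simpa [this] using M.rep_zero
  | @homogeneous n x =>
    have hx : τ [(x : H)] ∈ A.deg n :=
      mem_of_deg_eq (hh [(x : H)] [n] (.cons x.2 .nil)) (by simp)
    rw [koszulSign_of_mem _ _ hx, koszulSign_of_mem _ _ x.2]
    exact (hr x).zsmul _
  | add x y hx hy => rw [hadd, map_add, map_add]; exact hx.add hy

/-- A twisting cochain up to arity `N`. -/
structure IsPartialTwisting (M : HomologyModel A 𝓗) (N : ℕ) (τ : List H → A.carrier) : Prop where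
  multi : IsMulti k τ
  nil : τ [] = 0
  homog : IsHomog 𝓗 A.deg 1 τ
  rep : ∀ x, M.Rep (τ [x]) x
  flat : ∀ l : List H, l.length ≤ N → curvature (signHom A.deg) A.d τ l = 0

theorem isHomog_curvature {τ : List H → A.carrier} (hτ : IsHomog 𝓗 A.deg 1 τ) :
    IsHomog 𝓗 A.deg 2 (curvature (signHom A.deg) A.d τ) :=
  IsHomog.twistD (𝒜 := A.deg) (fun _ _ => signHom_mem A.deg) (fun _ _ => A.d_mem) hτ hτ

theorem isMulti_curvature {τ : List H → A.carrier} (hτ : IsMulti k τ) :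
    IsMulti k (curvature (signHom A.deg) A.d τ) :=
  IsMulti.twistD (signHom A.deg) A.d hτ hτ

/-- If the curvature is exact in arity `N + 1`, it can be killed by changing `τ` there. -/
theorem IsPartialTwisting.extend {N : ℕ} (hN : 1 ≤ N) {τ : List H → A.carrier}
    (hτ : M.IsPartialTwisting N τ)
    (hex : ∀ l : List H, l.length = N + 1 → ∃ b, A.d b = curvature (signHom A.deg) A.d τ l) :
    ∃ τ', M.IsPartialTwisting (N + 1) τ' ∧ ∀ l : List H, l.length ≤ N → τ' l = τ l := by
  obtain ⟨r, hr, hdr⟩ := A.exists_contraction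
  -- By `curvature_add_of_eq`, adding `w` changes the curvature in arity `N + 1` by `(-1) ^ (N + 1)
  -- • d w`, so this sign makes the change its negative.
  set w : List H → A.carrier := (-1 : k) ^ N •
    trunc (N + 1) fun l => r (curvature (signHom A.deg) A.d τ l) with hw
  have hwm : IsMulti k w := (((isMulti_curvature hτ.multi).comp r).trunc _).smul _
  have hwh : IsHomog 𝓗 A.deg 1 w :=
    (((isHomog_curvature hτ.homog).comp r hr).trunc _).smul _
  have hw0 : ∀ l : List H, l.length < N + 1 → w l = 0 := fun l hl => by
    rw [hw, Pi.smul_apply, trunc_of_length_ne _ hl.ne, smul_zero]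
  refine ⟨τ + w, ⟨hτ.multi.add hwm, by simp [hτ.nil, hw0], hτ.homog.add hwh, fun x => ?_,
    fun l hl => ?_⟩, fun l hl => by simp [hw0 l (by omega)]⟩
  · rw [Pi.add_apply, hw0 [x] (by simp; omega), add_zero]
    exact hτ.rep x
  · rcases hl.lt_or_eq with hl | hl
    · rw [curvature_add_of_lt _ τ hw0 hl, hτ.flat l (by omega)]
    · obtain ⟨b, hb⟩ := hex l hl
      rw [curvature_add_of_eq _ (Nat.succ_pos N) hτ.nil hw0 hl, hw, Pi.smul_apply,
        trunc_of_length_eq _ hl, map_smul, ← hb, hdr, pow_succ, mul_neg_one, neg_smul]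
      rcases neg_one_pow_eq_or k N with h | h <;> rcases Nat.even_or_odd N with h' | h' <;>
        simp [h'.neg_one_pow]

variable (M) in
-- A linear section `s` of cocycles is flat through arity 1. Its curvature `s x * s y - s (x * y)`
-- in arity 2 represents zero, hence is exact and removable without any Hochschild hypothesis.
theorem exists_isPartialTwisting_two : ∃ τ, M.IsPartialTwisting 2 τ := by
  obtain ⟨s, hs, hr⟩ := exists_section M
  let τ : List H → A.carrier := trunc 1 fun l => s (l.headD 0)
  have h1 : ∀ x, τ [x] = s x := fun x => rfl
  have h2 : ∀ l : List H, l.length ≠ 1 → τ l = 0 := fun l hl => trunc_of_length_ne _ hl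
  have hτ : M.IsPartialTwisting 1 τ := by
    refine ⟨?_, h2 _ (by simp), ?_, fun x => hr x, fun l hl => ?_⟩
    · intro l₁ l₂ c x y
      by_cases h : l₁.length + (l₂.length + 1) = 1
      · obtain rfl : l₁ = [] := List.length_eq_zero_iff.1 (by omega)
        obtain rfl : l₂ = [] := List.length_eq_zero_iff.1 (by omega)
        simp [h1]
      · rw [h2 _ (by simpa using h), h2 _ (by simpa using h), h2 _ (by simpa using h)]
        simp
    · intro l p h
      cases h with
      | nil => exact zero_mem _
      | @cons x n l p hx h =>
        cases h with
        | nil => exact mem_of_deg_eq (hs n x hx) (by simp)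
        | cons hy h => rw [h2 _ (by simp)]; exact zero_mem _
    · match l with
      | [] => simp [curvature, h2]
      | [x] => simp [curvature, barD_cons, cup_cons, h2, parity, h1, (hr x).d_eq_zero]
      | _ :: _ :: _ => simp at hl
  obtain ⟨τ', h, -⟩ := hτ.extend le_rfl (fun l hl => by
    match l with
    | [x, y] =>
      have e : curvature (signHom A.deg) A.d τ [x, y] = s x * s y - s (x * y) := by
        simp [curvature, barD_cons, cup_cons, h2, parity, h1, signHom_signHom]
        abel
      rw [e]
      refine Rep.exists_d (M := M) ?_
      simpa using ((hr x).mul (hr y)).sub (hr (x * y)))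
  exact ⟨τ', h⟩

/-- The obstruction to extending a partial twisting cochain is a Hochschild class; if it vanishes,
the extension exists after changing the top component. -/
theorem IsPartialTwisting.exists_succ {N : ℕ} (hN : 2 ≤ N)
    (hHH : Subsingleton (HH 𝓗 (N + 1) (2 - ((N + 1 : ℕ) : ℤ)))) {τ : List H → A.carrier}
    (hτ : M.IsPartialTwisting N τ) :
    ∃ τ', M.IsPartialTwisting (N + 1) τ' ∧ ∀ l : List H, l.length < N → τ' l = τ l := by
  classical
  have hA := A.isTwistedDifferential
  set m : ℤ := 2 - ((N + 1 : ℕ) : ℤ) with hm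
  have hK : koszulSign 𝓗 m = koszulSign 𝓗 ((N + 1 : ℕ) : ℤ) := by
    refine koszulSign_congr 𝓗 ⟨-N, ?_⟩
    rw [hm]
    push_cast
    ring
  set F := curvature (signHom A.deg) A.d τ with hF
  have hFm : IsMulti k F := isMulti_curvature hτ.multi
  have hFh : IsHomog 𝓗 A.deg 2 F := isHomog_curvature hτ.homog
  have hF0 : ∀ l : List H, l.length < N + 1 → F l = 0 := fun l hl => hτ.flat l (by omega)
  have hB := hA.bianchi τ
  rw [← hF] at hB
  have hτ1 := length_lt_one hτ.nil
  -- The Bianchi identity in arity `N + 1`: as `F` starts there and `τ` in arity 1, only the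
  -- internal differential survives.
  have hFd : ∀ l : List H, l.length = N + 1 → A.d (F l) = 0 := by
    intro l hl
    have h := congrFun hB l
    rw [barD_apply, barD_zero_eq_zero fun l' hl' => hF0 l' (by omega), Pi.sub_apply,
      cup_eq_zero _ (p := N + 1) (q := 1) (fun l h => parity_eq_zero _ (hF0 l h)) hτ1 (by omega),
      cup_eq_zero _ (p := 1) hτ1 hF0 (by omega), add_zero, sub_zero] at h
    rcases neg_one_pow_eq_or ℤ l.length with h' | h' <;> rw [h'] at h <;> simpa using h
  set γ : List H → H := fun l =>
    if h : l.length = N + 1 then M.π ⟨F l, hFd l h⟩ else 0 with hγ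
  have hγr : ∀ l : List H, l.length = N + 1 → M.Rep (F l) (γ l) := fun l h => by
    simp only [hγ, dif_pos h]
    exact ⟨hFd l h, rfl⟩
  have hγ0 : ∀ l : List H, l.length ≠ N + 1 → γ l = 0 := fun l h => dif_neg h
  have hγm : IsMulti k γ := by
    intro l₁ l₂ c x y
    by_cases h : l₁.length + (l₂.length + 1) = N + 1
    · have h1 := hγr (l₁ ++ (x + c • y) :: l₂) (by simpa using h)
      rw [hFm] at h1
      exact h1.unique ((hγr (l₁ ++ x :: l₂) (by simpa using h)).add
        ((hγr (l₁ ++ y :: l₂) (by simpa using h)).smul c))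
    · rw [hγ0 _ (by simpa using h), hγ0 _ (by simpa using h), hγ0 _ (by simpa using h)]
      simp
  have hγh : IsHomog 𝓗 𝓗 2 γ := by
    intro l p hp
    by_cases h : l.length = N + 1
    · exact (hγr l h).mem (hFh l p hp)
    · rw [hγ0 l h]
      exact zero_mem _
  have hGmem := toMultilinear_mem (m := m) (n := N + 1) hγm hγh hm
  -- The Bianchi identity one arity higher: the internal differential of `F` is now exact, and on
  -- classes the bar term and the two products with `τ` in arity 1 form the Hochschild differential
  -- of `γ`.
  have hδ : hochschildDelta 𝓗 (N + 1) m (toMultilinear (N + 1) hγm) = 0 := by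
    ext x
    have hx1 : List.ofFn x = x 0 :: List.ofFn (Fin.tail x) := List.ofFn_succ
    have hx2 : List.ofFn x = List.ofFn (Fin.init x) ++ [x (Fin.last (N + 1))] :=
      List.ofFn_succ_last
    have h := congrFun hB (List.ofFn x)
    have e1 : cup (signHom A.deg) (parity (signHom A.deg) F) τ (List.ofFn x) =
        (-1 : ℤ) ^ (N + 1) • (F (List.ofFn (Fin.init x)) * τ [x (Fin.last (N + 1))]) := by
      rw [hx2, cup_append _ (l₂ := [x (Fin.last (N + 1))])
        (fun l hl => parity_eq_zero _ (hF0 l (by simpa using hl))) hτ1]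
      simp [parity, signHom_signHom, -zsmul_eq_mul]
    have e2 : cup (signHom A.deg) τ F (List.ofFn x) =
        (signHom A.deg ^ (N + 1)) (τ [x 0]) * F (List.ofFn (Fin.tail x)) := by
      rw [hx1, ← List.singleton_append, cup_append _ (l₁ := [x 0]) hτ1
        (fun l hl => hF0 l (by simpa using hl)), List.length_ofFn]
    rw [barD_apply, Pi.sub_apply, e1, e2] at h
    have h1 := ((M.rep_d (F (List.ofFn x))).zsmul ((-1) ^ (List.ofFn x).length)).add
      (Rep.barD (φ := F) (γ := γ) (l := List.ofFn x) fun l' hl' => hγr l' (by simpa using hl'))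
    rw [h] at h1
    have h2 := h1.unique ((((hγr (List.ofFn (Fin.init x)) (by simp)).mul
      (hτ.rep (x (Fin.last (N + 1))))).zsmul ((-1) ^ (N + 1))).sub
      ((rep_signHom_pow hτ.multi hτ.homog hτ.rep (N + 1) (x 0)).mul
        (hγr (List.ofFn (Fin.tail x)) (by simp))))
    rw [smul_zero, zero_add] at h2
    rw [hochschildDelta_eq_barD m _ (φ := γ) (fun _ => rfl), h2, hK, pow_succ _ (N + 1), mul_neg_one,
      neg_smul]
    simp
  obtain ⟨g, hg, hgδ⟩ := exists_hochschildDelta_eq hHH hGmem hδ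
  -- The sign undoes the global factor `(-1) ^ m` of the Hochschild differential and makes the
  -- bracketed sum for `c • g` equal to `-γ`.
  set c : ℤ := -(m.negOnePow : ℤ) with hc
  set γ' : List H → H := ofMultilinear (c • g) with hγ'
  have hγ'm : IsMulti k γ' := isMulti_ofMultilinear _
  have hγ'h : IsHomog 𝓗 𝓗 1 γ' := by
    refine isHomog_ofMultilinear (m := m) (zsmul_mem hg c) ?_
    rw [hm]
    push_cast
    ring
  let s : H →ₗ[k] A.carrier :=
    { toFun := fun x => τ [x]
      map_add' := fun x y => by simpa using hτ.multi [] [] 1 x y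
      map_smul' := fun a x => by
        have h0 : τ [0] = 0 := by simpa using hτ.multi [] [] 1 0 0
        simpa [h0] using hτ.multi [] [] a 0 x }
  have hs : ∀ n, ∀ x ∈ 𝓗 n, s x ∈ A.deg (n + 0) := fun n x hx =>
    mem_of_deg_eq (hτ.homog [x] [n] (.cons hx .nil)) (by simp)
  set w : List H → A.carrier := fun l => s (γ' l) with hw
  have hwm : IsMulti k w := hγ'm.comp s
  have hwh : IsHomog 𝓗 A.deg 1 w := hγ'h.comp s hs
  have hw0 : ∀ l : List H, l.length ≠ N → w l = 0 := fun l hl => by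
    simp only [hw, hγ', ofMultilinear_of_ne _ hl, map_zero]
  have hwr : ∀ l, M.Rep (w l) (γ' l) := fun l => hτ.rep (γ' l)
  have hw0' : ∀ l : List H, l.length < N → w l = 0 := fun l hl => hw0 l hl.ne
  -- The values of `w` are cocycles, so changing `τ` in arity `N` does not disturb flatness there.
  have hτw : M.IsPartialTwisting N (τ + w) := by
    refine ⟨hτ.multi.add hwm, by simp [hτ.nil, hw0' [] (by simp; omega)], hτ.homog.add hwh,
      fun x => ?_, fun l hl => ?_⟩
    · rw [Pi.add_apply, hw0 [x] (by simp; omega), add_zero]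
      exact hτ.rep x
    · rcases hl.lt_or_eq with hl' | hl'
      · rw [curvature_add_of_lt _ τ hw0' hl', hτ.flat l hl]
      · rw [curvature_add_of_eq _ (by omega) hτ.nil hw0' hl', hτ.flat l hl, (hwr l).d_eq_zero,
          smul_zero, add_zero]
  -- The new curvature in arity `N + 1` represents `γ` plus the bracketed sum for `c • g`, which is
  -- zero; hence it is exact.
  obtain ⟨τ', hτ', hagree⟩ := hτw.extend (by omega) (fun l hl => by
    obtain ⟨x, rfl⟩ := exists_eq_ofFn hl
    have hx1 : List.ofFn x = x 0 :: List.ofFn (Fin.tail x) := List.ofFn_succ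
    have hx2 : List.ofFn x = List.ofFn (Fin.init x) ++ [x (Fin.last N)] :=
      List.ofFn_succ_last
    have h1 : hochschildDelta 𝓗 N m (c • g) x = -(m.negOnePow : ℤ) • γ (List.ofFn x) := by
      rw [map_zsmul, hgδ]
      rfl
    have h2 := hochschildDelta_eq_barD (𝓗 := 𝓗) m (c • g) (φ := γ')
      (fun x => (ofMultilinear_ofFn _ x).symm) x
    rw [h1, neg_smul, ← smul_neg] at h2
    have h3 := congrArg (fun t => (m.negOnePow : ℤ) • t) h2
    simp only [smul_smul, ← Units.val_mul, Int.units_mul_self, Units.val_one, one_smul] at h3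
    have h4 := curvature_add_of_eq_succ (signHom A.deg) (d := A.d) hA.invol hN hτ.nil hw0
      (x := x 0) (y := x (Fin.last N)) (l₁ := List.ofFn (Fin.tail x))
      (l₂ := List.ofFn (Fin.init x)) (by simp) (by simp) (hx1.symm.trans hx2)
    rw [← hx1] at h4
    rw [h4]
    refine Rep.exists_d (M := M) ?_
    have h5 := (hγr (List.ofFn x) (by simp)).add
      (((Rep.barD (φ := w) (γ := γ') (l := List.ofFn x) fun l' _ => hwr l').add
        ((rep_signHom_pow hτ.multi hτ.homog hτ.rep (N + 1) (x 0)).mul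
          (hwr (List.ofFn (Fin.tail x))))).add
      (((hwr (List.ofFn (Fin.init x))).mul (hτ.rep (x (Fin.last N)))).zsmul ((-1) ^ (N + 1))))
    rw [← hK, add_comm (barD (0 : H →ₗ[k] H) γ' (List.ofFn x)), ← h3, add_neg_cancel] at h5
    exact h5)
  exact ⟨τ', hτ', fun l hl => by rw [hagree l hl.le, Pi.add_apply, hw0' l hl, add_zero]⟩

variable (M) in
theorem exists_isTwisting (hHH : ∀ n : ℕ, 3 ≤ n → Subsingleton (HH 𝓗 n (2 - (n : ℤ)))) :
    ∃ τ, IsTwisting M τ := by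
  obtain ⟨τ₀, h₀⟩ := M.exists_isPartialTwisting_two
  have step : ∀ (n : ℕ) (τ : {τ // M.IsPartialTwisting (n + 2) τ}),
      ∃ τ' : {τ // M.IsPartialTwisting (n + 1 + 2) τ},
        ∀ l : List H, l.length < n + 2 → τ'.1 l = τ.1 l := fun n τ => by
    obtain ⟨τ', h, h'⟩ := τ.2.exists_succ (by omega) (hHH (n + 2 + 1) (by omega))
    exact ⟨⟨τ', by convert h using 1⟩, h'⟩
  choose next hnext using step
  obtain ⟨seq, hp, hsucc⟩ : ∃ seq : ℕ → List H → A.carrier,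
      (∀ n, M.IsPartialTwisting (n + 2) (seq n)) ∧
        ∀ n, ∀ l : List H, l.length < n + 2 → seq (n + 1) l = seq n l := by
    let s : ∀ n, {τ // M.IsPartialTwisting (n + 2) τ} := fun n => Nat.rec ⟨τ₀, h₀⟩ next n
    exact ⟨fun n => (s n).1, fun n => (s n).2, fun n => hnext n (s n)⟩
  have hseq : ∀ (n : ℕ) (l : List H), l.length ≤ n → seq n l = seq l.length l := by
    intro n l hl
    induction n, hl using Nat.le_induction with
    | base => rfl
    | succ n hn ih => rw [hsucc n l (by omega), ih]
  -- The limit reads each arity off a stage at which it has stabilised. Flatness transfers because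
  -- the curvature at `l` involves `τ` only in arities up to the length of `l`.
  refine ⟨fun l => seq l.length l, ⟨?_, (hp 0).nil, ?_, fun x => (hp 1).rep x, ?_⟩⟩
  · intro l₁ l₂ c x y
    simpa only [List.length_append, List.length_cons] using
      (hp (l₁.length + (l₂.length + 1))).multi l₁ l₂ c x y
  · exact fun l p h => (hp l.length).homog l p h
  · funext l
    rw [curvature_congr (signHom A.deg) (τ' := seq l.length)
      (fun l' hl' => (hseq l.length l' hl').symm)]
    exact (hp l.length).flat l (by omega)

end HomologyModel

/-- If the Hochschild groups `HH^{n,2-n}` with `n ≥ 3` of a graded algebra vanish, every dga with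
this homology algebra is formal. -/
theorem HomologyModel.quasiIsomorphic [Field k] [Algebra k H] {A : DGA.{u, v} k}
    {𝓗 : ℤ → Submodule k H} [GradedAlgebra 𝓗] (M : HomologyModel A 𝓗)
    (hHH : ∀ n : ℕ, 3 ≤ n → Subsingleton (HH 𝓗 n (2 - (n : ℤ)))) :
    QuasiIsomorphic A (ofGradedAlgebra 𝓗) := by
  obtain ⟨τ, hτ⟩ := M.exists_isTwisting hHH
  exact hτ.quasiIsomorphic

/-- An isomorphism of graded homology algebras identifies the homology of the second dga with that
of the first. -/
noncomputable def HomologyModel.ofEquiv [CommRing k] {A B : DGA.{u, v} k}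
    (e : A.Homology ≃ₐ[k] B.Homology)
    (he : ∀ (n : ℤ) (x : A.Homology), x ∈ A.homologyDeg n ↔ e x ∈ B.homologyDeg n) :
    HomologyModel B A.homologyDeg where
  π := e.symm.toAlgHom.comp B.toHomology
  exists_cocycle n x hx := by
    obtain ⟨z, hz, h⟩ := B.mem_homologyDeg.1 ((he n x).1 hx)
    refine ⟨z, hz, ?_⟩
    change e.symm (B.toHomology z) = x
    rw [h, e.symm_apply_apply]
  ker z := by
    change e.symm (B.toHomology z) = 0 ↔ _
    rw [map_eq_zero_iff e.symm e.symm.injective, B.toHomology_eq_zero]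
  map_deg n z hz := by
    change e.symm (B.toHomology z) ∈ _
    rw [he, e.apply_symm_apply]
    exact B.mem_homologyDeg.2 ⟨z, hz, rfl⟩

end Obstruction

end DGA

theorem corollary5p4 {k : Type u} [Field k] (A : DGA.{u, v} k)
    (hHH : ∀ n : ℕ, 3 ≤ n → Subsingleton (HH A.homologyDeg n (2 - (n : ℤ)))) :
    A.IntrinsicallyFormal := by
  rintro A' ⟨e, he⟩
  -- Both dgas are compared with the same target, the homology algebra of `A` with zero
  -- differential; for `A` itself the identity serves as the identification.
  have h₁ := (DGA.HomologyModel.ofEquiv e he).quasiIsomorphic hHH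
  have h₂ := (DGA.HomologyModel.ofEquiv (A := A) AlgEquiv.refl fun _ _ => Iff.rfl).quasiIsomorphic
    hHH
  exact h₁.trans _ _ _ (h₂.symm _ _)
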